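/- Let $N,K,Q,\tau$ be natural numbers with $K\le\tau$, let $\sigma>0$, $p_k\ge 0$, $p_k^{\mathrm{tr}}\ge 0$ for $1\le k\le K$, and let $\Phi=[\varphi_1,\dots,\varphi_K]\in\mathbb C^{\tau\times K}$ satisfy $\Phi^H\Phi=\tau I_K$. Let $\varpi_{k,q}\sim\mathcal{CN}(0,1)$ ($1\le k\le K$, $1\le q\le Q$) and the entries of $Z\in\mathbb C^{N\times\tau}$, distributed as $\mathcal{CN}(0,\sigma^2)$, be jointly independent (circularly symmetric) complex Gaussian random variables. For deterministic $\mu_k\in\mathbb C^N$ and $B_k\in\mathbb C^{N\times Q}$, consider the Rician channels $h_k=\mu_k+B_k\varpi_k$ with $\varpi_k=(\varpi_{k,1},\dots,\varpi_{k,Q})^T$, put $R_k=B_kB_k^H$, and let $$y_k=\tfrac1{\sqrt\tau}\Big(\sum_{i=1}^K\sqrt{p_i^{\mathrm{tr}}}\,h_i\varphi_i^T+Z\Big)\varphi_k^*$$ be the despread pilot observation of user $k$. Let $\hat h_k=\mathbb E[h_k]+C_{h_ky_k}C_{y_k}^{-1}(y_k-\mathbb E[y_k])$ be the LMMSE estimate,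 where $C_{h_ky_k}=\mathbb E[(h_k-\mathbb E h_k)(y_k-\mathbb E y_k)^H]$ and $C_{y_k}=\mathbb E[(y_k-\mathbb E y_k)(y_k-\mathbb E y_k)^H]$. Put $$C_{\hat h_k}=\mathbb E[(\hat h_k-\mu_k)(\hat h_k-\mu_k)^H],\quad C_{e,k}=\mathbb E[(h_k-\hat h_k)(h_k-\hat h_k)^H],\quad \Sigma_{h,k}=\mathbb E[h_kh_k^H],\quad \Sigma_{\hat h,k}=\mathbb E[\hat h_k\hat h_k^H].$$ With maximum-ratio combining $v_k=\hat h_k$, the use-and-then-forget (UatF) SINR of user $k$ is $$\bar\gamma_k^{\mathrm{MRC}}=\frac{p_k\,|\mathbb E[v_k^Hh_k]|^2}{\sum_{i=1}^Kp_i\,\mathbb E[|v_k^Hh_i|^2]-p_k\,|\mathbb E[v_k^Hh_k]|^2+\sigma^2\,\mathbb E[\|v_k\|^2]}.$$ Then, for every user $k$: (a) $\hat h_k=\mu_k+\sqrt{\tau p_k^{\mathrm{tr}}}\,R_k(\tau p_k^{\mathrm{tr}}R_k+\sigma^2I_N)^{-1}\big(y_k-\sqrt{\tau p_k^{\mathrm{tr}}}\,\mu_k\big)$,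 and $\hat h_k=\mathbb E[h_k\mid y_k]$ almost surely. (b) All the expectations above are finite, and, with $a_k=\tau p_k^{\mathrm{tr}}$, $$C_{\hat h_k}=a_kR_k(a_kR_k+\sigma^2I_N)^{-1}R_k,\qquad C_{e,k}=R_k-C_{\hat h_k}=R_k\big(I_N+\tfrac{a_k}{\sigma^2}R_k\big)^{-1},$$ $$\Sigma_{h,k}=R_k+\mu_k\mu_k^H,\qquad \Sigma_{\hat h,k}=C_{\hat h_k}+\mu_k\mu_k^H,$$ and $C_{\hat h_k}$ and $C_{e,k}$ are positive semidefinite. (c) Let $$\alpha_k=\operatorname{tr}(C_{\hat h_k})+\|\mu_k\|^2,\qquad \Phi_k=\operatorname{tr}(C_{\hat h_k}^2)+2\mu_k^HC_{\hat h_k}\mu_k+\operatorname{tr}(C_{e,k}\Sigma_{\hat h,k}),$$ $$I_k^{\mathrm{MRC}}=p_k\Phi_k+\sum_{i\ne k}p_i\operatorname{tr}(\Sigma_{h,i}\Sigma_{\hat h,k})+\sigma^2\alpha_k .$$ Then $\mathbb E[v_k^Hh_k]=\mathbb E[\|v_k\|^2]=\alpha_k$, the self-interference $\mathbb E[|v_k^Hh_k|^2]-|\mathbb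 E[v_k^Hh_k]|^2$ equals $\Phi_k$, the denominator of $\bar\gamma_k^{\mathrm{MRC}}$ equals $I_k^{\mathrm{MRC}}$, which is positive whenever $\alpha_k>0$, and $$\bar\gamma_k^{\mathrm{MRC}}=\frac{p_k\alpha_k^2}{I_k^{\mathrm{MRC}}}$$ (if a denominator vanishes, both sides are read as $0$). (d) This covers the geometry-based rotatable-antenna channel. Let $w_n,u_k,c_q\in\mathbb R^3$ be the positions of antennas, users and scatterer clusters, with $u_k\ne w_n$, $c_q\ne w_n$, $u_k\ne c_q$, let $\lambda,\varrho,\sigma_q>0$, $b\ge0$, and let $F=[f_1,\dots,f_N]$ be any unit boresight vectors. For a point $x$ put $g_n(x)=\varrho\,\frac{2(2b+1)\max\{f_n^Ts,0\}^{2b}}{4\pi\|x-w_n\|^2}$ with $s=\frac{x-w_n}{\|x-w_n\|}$. Then the channel $$h_{k,n}(F)=\sqrt{g_n(u_k)}\,e^{-j\frac{2\pi}\lambda\|u_k-w_n\|}+\sum_{q=1}^Q\varpi_{k,q}\frac{\sqrt{\sigma_q\,g_n(c_q)}}{\|u_k-c_q\|}e^{-j\frac{2\pi}\lambda(\|c_q-w_n\|+\|u_k-c_q\|)}$$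 has the form $h_k(F)=\mu_k(F)+B_k(F)\varpi_k$, where $\mu_k(F)$ consists of the first terms and $B_k(F)$ of the coefficients of the $\varpi_{k,q}$. -/

import Mathlib

open MeasureTheory ProbabilityTheory Matrix
open scoped NNReal ComplexOrder

/-- The circularly symmetric complex Gaussian law `CN(0, v)`: real and imaginary parts are
independent real Gaussians of mean `0` and variance `v / 2`. -/
noncomputable def complexGaussian (v : ℝ≥0) : Measure ℂ :=
  ((gaussianReal 0 (v / 2)).prod (gaussianReal 0 (v / 2))).map
    Complex.measurableEquivRealProd.symm

section Moments

variable {Ω : Type*} [MeasurableSpace Ω]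

/-- The mean `E[x]` of a random complex vector, entrywise. -/
noncomputable def meanVec {m : ℕ} (P : Measure Ω) (x : Ω → Fin m → ℂ) : Fin m → ℂ :=
  fun i => ∫ ω, x ω i ∂P

/-- The matrix `E[x y^H]`, entrywise. -/
noncomputable def crossMoment {m n : ℕ} (P : Measure Ω) (x : Ω → Fin m → ℂ)
    (y : Ω → Fin n → ℂ) : Matrix (Fin m) (Fin n) ℂ :=
  Matrix.of fun i j => ∫ ω, x ω i * star (y ω j) ∂P

/-- The cross-covariance matrix `E[(x - E x) (y - E y)^H]`. -/
noncomputable def crossCov {m n : ℕ} (P : Measure Ω) (x : Ω → Fin m → ℂ)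
    (y : Ω → Fin n → ℂ) : Matrix (Fin m) (Fin n) ℂ :=
  crossMoment P (fun ω => x ω - meanVec P x) (fun ω => y ω - meanVec P y)

/-- The linear minimum-mean-squared-error estimate of `x` from `y`,
`E x + C_{xy} C_{yy}⁻¹ (y - E y)`. -/
noncomputable def lmmse {m n : ℕ} (P : Measure Ω) (x : Ω → Fin m → ℂ)
    (y : Ω → Fin n → ℂ) (ω : Ω) : Fin m → ℂ :=
  meanVec P x + (crossCov P x y * (crossCov P y y)⁻¹) *ᵥ (y ω - meanVec P y)

end Moments

section Channel

variable {Ω : Type*} {N K Q τ : ℕ}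

/-- The Rician channel `h_k = μ_k + B_k ϖ_k`. -/
def ricianChannel (μ : Fin K → Fin N → ℂ) (B : Fin K → Matrix (Fin N) (Fin Q) ℂ)
    (ϖ : Fin K → Fin Q → Ω → ℂ) (k : Fin K) (ω : Ω) : Fin N → ℂ :=
  μ k + B k *ᵥ fun q => ϖ k q ω

/-- The received pilot matrix `Y_p = ∑ k, √(p_k^tr) h_k φ_k^T + Z_p`; the pilot `φ_k` is the
`k`-th column of `Φ`. -/
noncomputable def pilotMatrix (ptr : Fin K → ℝ) (Φ : Matrix (Fin τ) (Fin K) ℂ)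
    (h : Fin K → Ω → Fin N → ℂ) (Z : Fin N → Fin τ → Ω → ℂ) (ω : Ω) :
    Matrix (Fin N) (Fin τ) ℂ :=
  ∑ k, ((Real.sqrt (ptr k) : ℝ) : ℂ) • Matrix.vecMulVec (h k ω) (fun t => Φ t k)
    + Matrix.of fun n t => Z n t ω

/-- The despread pilot observation `y_{p,k} = τ^{-1/2} Y_p φ_k^*`. -/
noncomputable def pilotObs (ptr : Fin K → ℝ) (Φ : Matrix (Fin τ) (Fin K) ℂ)
    (h : Fin K → Ω → Fin N → ℂ) (Z : Fin N → Fin τ → Ω → ℂ) (k : Fin K) (ω : Ω) :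
    Fin N → ℂ :=
  ((1 / Real.sqrt τ : ℝ) : ℂ) • (pilotMatrix ptr Φ h Z ω *ᵥ star fun t => Φ t k)

end Channel

section SINR

variable {Ω : Type*} [MeasurableSpace Ω] {N K : ℕ}

/-- The denominator of the use-and-then-forget SINR of user `k` with combiners `v`,
`∑ i, p_i E|v_k^H h_i|² - p_k |E[v_k^H h_k]|² + σ² E‖v_k‖²`. -/
noncomputable def uatfDenominator (P : Measure Ω) (p : Fin K → ℝ) (σ : ℝ)
    (h v : Fin K → Ω → Fin N → ℂ) (k : Fin K) : ℝ :=
  ∑ i, p i * ∫ ω, ‖star (v k ω) ⬝ᵥ h i ω‖ ^ 2 ∂P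
    - p k * ‖∫ ω, star (v k ω) ⬝ᵥ h k ω ∂P‖ ^ 2
    + σ ^ 2 * ∫ ω, ‖WithLp.toLp 2 (v k ω)‖ ^ 2 ∂P

/-- The (unconditional) use-and-then-forget SINR of user `k` with combiners `v`. -/
noncomputable def uatfSINR (P : Measure Ω) (p : Fin K → ℝ) (σ : ℝ)
    (h v : Fin K → Ω → Fin N → ℂ) (k : Fin K) : ℝ :=
  p k * ‖∫ ω, star (v k ω) ⬝ᵥ h k ω ∂P‖ ^ 2 / uatfDenominator P p σ h v k

/-- Maximum-ratio combining: the combiner is the channel estimate. -/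
def mrcCombiner (hhat : Fin K → Ω → Fin N → ℂ) : Fin K → Ω → Fin N → ℂ := hhat

end SINR

section ClosedForm

variable {N K : ℕ}

/-- `α = tr C + ‖μ‖²`. -/
noncomputable def mrcAlpha (C : Matrix (Fin N) (Fin N) ℂ) (μ : Fin N → ℂ) : ℝ :=
  C.trace.re + ‖WithLp.toLp 2 μ‖ ^ 2

/-- The self-interference term `tr(C²) + 2 μ^H C μ + tr(C_e Σ)`. -/
noncomputable def mrcPhi (C Ce S : Matrix (Fin N) (Fin N) ℂ) (μ : Fin N → ℂ) : ℝ :=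
  (C ^ 2).trace.re + 2 * (star μ ⬝ᵥ (C *ᵥ μ)).re + (Ce * S).trace.re

/-- The interference-plus-noise term
`p_k Φ_k + ∑_{i ≠ k} p_i tr(Σ_{h,i} Σ_{ĥ,k}) + σ² α_k`. -/
noncomputable def mrcInterference (p : Fin K → ℝ) (σ : ℝ) (μ : Fin K → Fin N → ℂ)
    (C Ce Sh Shat : Fin K → Matrix (Fin N) (Fin N) ℂ) (k : Fin K) : ℝ :=
  p k * mrcPhi (C k) (Ce k) (Shat k) (μ k)
    + ∑ i ∈ Finset.univ.erase k, p i * (Sh i * Shat k).trace.re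
    + σ ^ 2 * mrcAlpha (C k) (μ k)

end ClosedForm

section Geometry

/-- Geometry and radio parameters of a rotatable-antenna array with `N` elements, `K` users and
`Q` scatterer clusters. -/
structure RAGeometry (N K Q : ℕ) where
  /-- antenna positions -/
  w : Fin N → EuclideanSpace ℝ (Fin 3)
  /-- user positions -/
  u : Fin K → EuclideanSpace ℝ (Fin 3)
  /-- cluster positions -/
  c : Fin Q → EuclideanSpace ℝ (Fin 3)
  /-- carrier wavelength -/
  wavelength : ℝ
  /-- physical size of an antenna -/
  size : ℝ
  /-- directional factor -/
  b : ℝ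
  /-- radar cross sections of the clusters -/
  rcs : Fin Q → ℝ
  wavelength_pos : 0 < wavelength
  size_pos : 0 < size
  b_nonneg : 0 ≤ b
  rcs_pos : ∀ q, 0 < rcs q
  user_ne_antenna : ∀ k n, u k ≠ w n
  cluster_ne_antenna : ∀ q n, c q ≠ w n
  user_ne_cluster : ∀ k q, u k ≠ c q

namespace RAGeometry

variable {N K Q : ℕ} (G : RAGeometry N K Q)

/-- The unit direction vector from antenna `n` to the point `x`. -/
noncomputable def direction (n : Fin N) (x : EuclideanSpace ℝ (Fin 3)) :
    EuclideanSpace ℝ (Fin 3) :=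
  ‖x - G.w n‖⁻¹ • (x - G.w n)

/-- The element pattern `G₀ [fᵀ s]₊^{2b}` with `G₀ = 2 (2 b + 1)`. -/
noncomputable def elementGain (f s : EuclideanSpace ℝ (Fin 3)) : ℝ :=
  2 * (2 * G.b + 1) * (max (inner ℝ f s) 0) ^ (2 * G.b)

/-- The large-scale power gain `ϱ G(f_n, s) / (4 π r²)` between antenna `n` with boresight `F n`
and a point `x` at distance `r` in direction `s`. -/
noncomputable def pathGain (F : Fin N → EuclideanSpace ℝ (Fin 3)) (n : Fin N)
    (x : EuclideanSpace ℝ (Fin 3)) : ℝ :=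
  G.size * (G.elementGain (F n) (G.direction n x) / (4 * Real.pi * ‖x - G.w n‖ ^ 2))

/-- The phase factor `exp(-j (2π/λ) r)` of a path of length `r`. -/
noncomputable def phase (r : ℝ) : ℂ :=
  Complex.exp (-Complex.I * ((2 * Real.pi / G.wavelength * r : ℝ) : ℂ))

/-- The line-of-sight vector `μ_k(F)`. -/
noncomputable def losMean (F : Fin N → EuclideanSpace ℝ (Fin 3)) (k : Fin K) : Fin N → ℂ :=
  fun n => ((Real.sqrt (G.pathGain F n (G.u k)) : ℝ) : ℂ) * G.phase ‖G.u k - G.w n‖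

/-- The scattering matrix `B_k(F)`. -/
noncomputable def nlosMatrix (F : Fin N → EuclideanSpace ℝ (Fin 3)) (k : Fin K) :
    Matrix (Fin N) (Fin Q) ℂ :=
  Matrix.of fun n q =>
    ((Real.sqrt (G.rcs q * G.pathGain F n (G.c q)) / ‖G.u k - G.c q‖ : ℝ) : ℂ)
      * G.phase (‖G.c q - G.w n‖ + ‖G.u k - G.c q‖)

/-- The geometry-based channel: line-of-sight path plus one faded path per cluster. -/
noncomputable def channel {Ω : Type*} (F : Fin N → EuclideanSpace ℝ (Fin 3))
    (ϖ : Fin K → Fin Q → Ω → ℂ) (k : Fin K) (ω : Ω) : Fin N → ℂ :=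
  fun n =>
    ((Real.sqrt (G.pathGain F n (G.u k)) : ℝ) : ℂ) * G.phase ‖G.u k - G.w n‖
      + ∑ q, ϖ k q ω
          * ((Real.sqrt (G.rcs q * G.pathGain F n (G.c q)) / ‖G.u k - G.c q‖ : ℝ) : ℂ)
          * G.phase (‖G.c q - G.w n‖ + ‖G.u k - G.c q‖)

end RAGeometry

end Geometry

/-! All random vectors involved are affine images of one finite family of independent circularly
symmetric complex Gaussians, the fading and noise variables. With `D` the diagonal matrix of their
variances, the covariance of two such images with linear parts `A` and `B` is `A * D * Bᴴ`.
Orthogonality of the pilots removes the other users from the despread observation, which becomes `y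
= √a h + noise` with `a = τ p^tr` and white noise of covariance `σ² I`.

The LMMSE gain `G` solves `G C_y = C_hy`, so the error `e = h - ĥ` is uncorrelated with `y`. For
circular Gaussians this already gives independence (`indepFun_mulVec`), because every real
covariance is half the real part of a Hermitian one. Hence `E[h | y] = ĥ`
(`condExp_comap_eq_of_indepFun`), and the covariance formulas are matrix algebra
(`lmmse_covariances`, `sub_smul_mul_inv_mul_eq`).

For the SINR, write `h = ĥ + e` with `e` centred and independent of `ĥ`. Then `E[ĥ^H h] = E‖ĥ‖²` and
`E|ĥ^H h|² = E‖ĥ‖⁴ + tr(C_e Σ_ĥ)`. The only fourth-order quantity left is `E‖ĥ‖⁴`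
(`integral_norm_sq_affine`). It rests on `E|x|²|y|² = E|x|² E|y|² + |E x y*|²`, which follows by
polarization from `E|x|⁴ = 2 (E|x|²)²`. The channel of another user is independent of `ĥ`, so its
interference is the trace of a product of second-moment matrices. -/

/-! ### Random variables with finite moments of every order -/

section AllMoments

variable {Ω : Type*} [MeasurableSpace Ω] {P : Measure Ω}

/-- All absolute moments of finite order exist. -/
def HasAllMoments {E : Type*} [NormedAddCommGroup E] (P : Measure Ω) (X : Ω → E) : Prop :=
  ∀ p : ENNReal, p ≠ ⊤ → MemLp X p P

namespace HasAllMoments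

theorem integrable {E : Type*} [NormedAddCommGroup E] {X : Ω → E} (hX : HasAllMoments P X) :
    Integrable X P :=
  memLp_one_iff_integrable.1 (hX 1 (by simp))

theorem add {E : Type*} [NormedAddCommGroup E] {X Y : Ω → E} (hX : HasAllMoments P X)
    (hY : HasAllMoments P Y) : HasAllMoments P (fun ω => X ω + Y ω) :=
  fun p hp => (hX p hp).add (hY p hp)

theorem sum {ι E : Type*} [NormedAddCommGroup E] {s : Finset ι} {X : ι → Ω → E}
    (hX : ∀ i ∈ s, HasAllMoments P (X i)) : HasAllMoments P (fun ω => ∑ i ∈ s, X i ω) :=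
  fun p hp => memLp_finsetSum s fun i hi => hX i hi p hp

/-- Hölder with both exponents doubled. The class is closed under products because it asks for every
finite exponent at once. -/
theorem mul {R : Type*} [NormedRing R] {X Y : Ω → R} (hX : HasAllMoments P X)
    (hY : HasAllMoments P Y) : HasAllMoments P (fun ω => X ω * Y ω) := by
  intro p hp
  have h2 : (2 * p) ≠ ⊤ := ENNReal.mul_ne_top (by simp) hp
  have : ENNReal.HolderTriple (2 * p) (2 * p) p := ⟨by
    rw [ENNReal.mul_inv (by simp) (by simp), ← add_mul, ENNReal.inv_two_add_inv_two, one_mul]⟩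
  exact (hY _ h2).mul (hX _ h2)

/-- The exponent is shifted by one to exclude the constant `1`, which would need `P` finite; so `pow
1` is the square and `pow 3` the fourth power. -/
theorem pow {R : Type*} [NormedRing R] {X : Ω → R} (hX : HasAllMoments P X) (n : ℕ) :
    HasAllMoments P (fun ω => X ω ^ (n + 1)) := by
  induction n with
  | zero => simpa using hX
  | succ n ih => simpa only [pow_succ _ (n + 1)] using ih.mul hX

theorem const [IsFiniteMeasure P] {E : Type*} [NormedAddCommGroup E] (c : E) :
    HasAllMoments P (fun _ => c) :=
  fun _ _ => memLp_const c

theorem star {X : Ω → ℂ} (hX : HasAllMoments P X) : HasAllMoments P (fun ω => star (X ω)) :=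
  fun p hp => (hX p hp).star

theorem norm {E : Type*} [NormedAddCommGroup E] {X : Ω → E} (hX : HasAllMoments P X) :
    HasAllMoments P (fun ω => ‖X ω‖) :=
  fun p hp => (hX p hp).norm

theorem re {X : Ω → ℂ} (hX : HasAllMoments P X) : HasAllMoments P (fun ω => (X ω).re) :=
  fun p hp => (hX p hp).re

theorem im {X : Ω → ℂ} (hX : HasAllMoments P X) : HasAllMoments P (fun ω => (X ω).im) :=
  fun p hp => (hX p hp).im

theorem ofReal {X : Ω → ℝ} (hX : HasAllMoments P X) : HasAllMoments P (fun ω => (X ω : ℂ)) :=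
  fun p hp => (hX p hp).ofReal

end HasAllMoments

end AllMoments

/-! ### Second and fourth moments of a real Gaussian -/

section ScalarGaussian

theorem integral_sq_gaussianReal (v : ℝ≥0) : ∫ x, x ^ 2 ∂gaussianReal 0 v = v := by
  have h := variance_id_gaussianReal (μ := 0) (v := v)
  rw [variance_of_integral_eq_zero (by fun_prop) (by simp)] at h
  simpa using h

/-- The fourth moment of a centred real Gaussian of variance `v` is `3 v²`. -/
theorem integral_pow_four_gaussianReal (v : ℝ≥0) :
    ∫ x, x ^ 4 ∂gaussianReal 0 v = 3 * (v : ℝ) ^ 2 := by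
  -- The moment is the fourth derivative at `0` of the moment generating function `exp (v t² / 2)`.
  -- Each derivative is a polynomial times this exponential, and `step` records how the polynomial
  -- changes.
  have h := iteratedDeriv_mgf_zero (X := id) (μ := gaussianReal 0 v) (by simp) 4
  have hE : ∀ t : ℝ, HasDerivAt (fun t : ℝ => Real.exp (v * t ^ 2 / 2))
      (Real.exp (v * t ^ 2 / 2) * (v * t)) t := fun t => by
    have h1 : HasDerivAt (fun t : ℝ => (v : ℝ) * t ^ 2 / 2) (v * t) t := by
      refine (((hasDerivAt_pow 2 t).const_mul (v : ℝ)).div_const 2).congr_deriv ?_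
      simp; ring
    exact h1.exp
  have step : ∀ (q q' : ℝ → ℝ), (∀ t, HasDerivAt q (q' t) t) →
      deriv (fun t => q t * Real.exp (v * t ^ 2 / 2))
        = fun t => (q' t + q t * (v * t)) * Real.exp (v * t ^ 2 / 2) := fun q q' hq => by
    funext t
    rw [((hq t).fun_mul (hE t)).deriv]
    ring
  have e1 : deriv (fun t : ℝ => Real.exp (v * t ^ 2 / 2))
      = fun t => (v * t) * Real.exp (v * t ^ 2 / 2) := by
    funext t
    rw [(hE t).deriv]
    ring
  have e2 := step (fun t => v * t) (fun _ => v) fun t => by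
    simpa using (hasDerivAt_id t).const_mul (v : ℝ)
  have e3 := step (fun t => (v : ℝ) + v * t * (v * t)) (fun t => 2 * v ^ 2 * t) fun t => by
    have h1 : HasDerivAt (fun t => (v : ℝ) * t) v t := by
      simpa using (hasDerivAt_id t).const_mul (v : ℝ)
    refine ((h1.fun_mul h1).const_add (v : ℝ)).congr_deriv ?_
    ring
  have e4 := step (fun t => 2 * (v : ℝ) ^ 2 * t + ((v : ℝ) + v * t * (v * t)) * (v * t))
      (fun t => 3 * v ^ 2 + 3 * v ^ 3 * t ^ 2) fun t => by
    have h1 : HasDerivAt (fun t => (v : ℝ) * t) v t := by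
      simpa using (hasDerivAt_id t).const_mul (v : ℝ)
    have h2 : HasDerivAt (fun t => 2 * (v : ℝ) ^ 2 * t) (2 * (v : ℝ) ^ 2) t := by
      simpa using (hasDerivAt_id t).const_mul (2 * (v : ℝ) ^ 2)
    refine (h2.add (((h1.fun_mul h1).const_add (v : ℝ)).fun_mul h1)).congr_deriv ?_
    ring
  rw [mgf_id_gaussianReal] at h
  simp only [zero_mul, zero_add, iteratedDeriv_succ, iteratedDeriv_zero] at h
  rw [e1, e2, e3, e4] at h
  simpa using h.symm

end ScalarGaussian

/-! ### The scalar law `CN(0, v)` -/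

section ComplexGaussian

theorem complexGaussian_eq_map (v : ℝ≥0) : complexGaussian v =
    ((gaussianReal 0 (v / 2)).prod (gaussianReal 0 (v / 2))).map
      Complex.equivRealProdCLM.symm := rfl

instance isGaussian_complexGaussian (v : ℝ≥0) : IsGaussian (complexGaussian v) := by
  rw [complexGaussian_eq_map]
  infer_instance

theorem integral_re_mul_im_complexGaussian (v : ℝ≥0) (f g : ℝ → ℝ) :
    ∫ z, f z.re * g z.im ∂complexGaussian v
      = (∫ x, f x ∂gaussianReal 0 (v / 2)) * ∫ x, g x ∂gaussianReal 0 (v / 2) := by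
  rw [complexGaussian, integral_map_equiv, ← integral_prod_mul]
  rfl

theorem hasAllMoments_id_complexGaussian (v : ℝ≥0) :
    HasAllMoments (complexGaussian v) (fun z => z) :=
  fun p hp => IsGaussian.memLp_id _ p hp

theorem integral_eq_re_add_im {Ω : Type*} [MeasurableSpace Ω] {P : Measure Ω} {f : Ω → ℂ}
    (hf : Integrable f P) :
    ∫ ω, f ω ∂P = ((∫ ω, (f ω).re ∂P : ℝ) : ℂ) + ((∫ ω, (f ω).im ∂P : ℝ) : ℂ) * Complex.I := by
  simpa using (integral_re_add_im hf).symm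

theorem integral_id_complexGaussian (v : ℝ≥0) : ∫ z, z ∂complexGaussian v = 0 := by
  rw [integral_eq_re_add_im (hasAllMoments_id_complexGaussian v).integrable]
  have h1 := integral_re_mul_im_complexGaussian v (fun x => x) (fun _ => 1)
  have h2 := integral_re_mul_im_complexGaussian v (fun _ => 1) (fun x => x)
  simp only [mul_one, one_mul] at h1 h2
  simp [h1, h2]

theorem integral_re_sq_complexGaussian (v : ℝ≥0) :
    ∫ z, z.re ^ 2 ∂complexGaussian v = v / 2 := by
  have h1 := integral_re_mul_im_complexGaussian v (fun x => x ^ 2) (fun _ => 1)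
  simpa [integral_sq_gaussianReal] using h1

theorem integral_im_sq_complexGaussian (v : ℝ≥0) :
    ∫ z, z.im ^ 2 ∂complexGaussian v = v / 2 := by
  have h1 := integral_re_mul_im_complexGaussian v (fun _ => 1) (fun x => x ^ 2)
  simpa [integral_sq_gaussianReal] using h1

/-- Circularity: the real and imaginary parts have equal variances, which cancel in `Re z²`, and are
uncorrelated, which kills `Im z²`. -/
theorem integral_mul_self_complexGaussian (v : ℝ≥0) :
    ∫ z, z * z ∂complexGaussian v = 0 := by
  have hid := hasAllMoments_id_complexGaussian v
  rw [integral_eq_re_add_im (hid.mul hid).integrable]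
  have h1 := integral_re_mul_im_complexGaussian v (fun x => x) (fun x => x)
  simp only [Complex.mul_re, Complex.mul_im]
  rw [integral_sub (hid.re.mul hid.re).integrable (hid.im.mul hid.im).integrable,
    integral_add (hid.re.mul hid.im).integrable (hid.im.mul hid.re).integrable]
  simp only [mul_comm (Complex.im _) (Complex.re _), h1, ← sq, integral_re_sq_complexGaussian,
    integral_im_sq_complexGaussian]
  simp

theorem integral_mul_star_complexGaussian (v : ℝ≥0) :
    ∫ z, z * star z ∂complexGaussian v = v := by
  have hid := hasAllMoments_id_complexGaussian v
  have : ∀ z : ℂ, z * star z = ((z.re ^ 2 + z.im ^ 2 : ℝ) : ℂ) := fun z => by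
    rw [Complex.star_def, Complex.mul_conj, Complex.normSq_apply]; push_cast; ring
  simp only [this]
  rw [integral_complex_ofReal, integral_add (hid.re.pow 1).integrable (hid.im.pow 1).integrable,
    integral_re_sq_complexGaussian, integral_im_sq_complexGaussian]
  push_cast; ring

theorem complexGaussian_map_neg (v : ℝ≥0) :
    (complexGaussian v).map (fun z => -z) = complexGaussian v := by
  have h : (gaussianReal 0 (v / 2)).map (fun x => -x) = gaussianReal 0 (v / 2) := by
    simpa using gaussianReal_map_neg (μ := 0) (v := v / 2)
  conv_rhs => rw [complexGaussian, ← h, Measure.map_prod_map _ _ (by fun_prop) (by fun_prop)]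
  rw [complexGaussian, Measure.map_map (by fun_prop) (by fun_prop),
    Measure.map_map (by fun_prop) (by fun_prop)]
  congr 1

end ComplexGaussian

/-! ### Linear forms in an independent complex Gaussian family -/

section Family

/-- Independent circularly symmetric complex Gaussian variables `ξ j` of variance `v j`. -/
structure IsComplexGaussianFamily {Ω J : Type*} [MeasurableSpace Ω] (P : Measure Ω)
    (v : J → ℝ≥0) (ξ : J → Ω → ℂ) : Prop where
  measurable : ∀ j, Measurable (ξ j)
  hasLaw : ∀ j, HasLaw (ξ j) (complexGaussian (v j)) P
  indep : iIndepFun ξ P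

namespace IsComplexGaussianFamily

variable {Ω J : Type*} [MeasurableSpace Ω] {P : Measure Ω}
  {v : J → ℝ≥0} {ξ : J → Ω → ℂ}

theorem vecMeasurable (hξ : IsComplexGaussianFamily P v ξ) : Measurable (fun ω j => ξ j ω) :=
  measurable_pi_lambda _ hξ.measurable

theorem hasAllMoments (hξ : IsComplexGaussianFamily P v ξ) (j : J) : HasAllMoments P (ξ j) :=
  fun _ hp => (hξ.hasLaw j).hasGaussianLaw.memLp hp

theorem integral_comp (hξ : IsComplexGaussianFamily P v ξ) (j : J) {f : ℂ → ℂ} (hf : Measurable f) :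
    ∫ ω, f (ξ j ω) ∂P = ∫ z, f z ∂complexGaussian (v j) :=
  (hξ.hasLaw j).integral_comp hf.aestronglyMeasurable

theorem integral_eq_zero (hξ : IsComplexGaussianFamily P v ξ) (j : J) : ∫ ω, ξ j ω ∂P = 0 :=
  (hξ.integral_comp j measurable_id).trans (integral_id_complexGaussian _)

/-- The pseudo-covariance vanishes, on the diagonal by circularity and off it by independence and
centring. -/
theorem integral_mul (hξ : IsComplexGaussianFamily P v ξ) (i j : J) :
    ∫ ω, ξ i ω * ξ j ω ∂P = 0 := by
  rcases eq_or_ne i j with rfl | hij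
  · exact (hξ.integral_comp i (f := fun z => z * z) (by fun_prop)).trans
      (integral_mul_self_complexGaussian _)
  · rw [(hξ.indep.indepFun hij).integral_fun_mul_eq_mul_integral
      (hξ.measurable i).aestronglyMeasurable (hξ.measurable j).aestronglyMeasurable,
      hξ.integral_eq_zero, zero_mul]

theorem integral_mul_star [DecidableEq J] (hξ : IsComplexGaussianFamily P v ξ) (i j : J) :
    ∫ ω, ξ i ω * star (ξ j ω) ∂P = if i = j then (v i : ℂ) else 0 := by
  split_ifs with hij
  · subst hij
    exact (hξ.integral_comp i (f := fun z => z * star z) (by fun_prop)).trans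
      (integral_mul_star_complexGaussian _)
  · have h := (hξ.indep.indepFun hij).comp (φ := fun z : ℂ => z) (ψ := fun z : ℂ => star z)
      measurable_id (by fun_prop)
    have := h.integral_mul_eq_mul_integral
      (hξ.measurable i).aestronglyMeasurable
      (continuous_star.measurable.comp (hξ.measurable j)).aestronglyMeasurable
    refine this.trans ?_
    change (∫ ω, ξ i ω ∂P) * _ = 0
    rw [hξ.integral_eq_zero, zero_mul]

variable [Fintype J]

theorem hasGaussianLaw (hξ : IsComplexGaussianFamily P v ξ) : HasGaussianLaw (fun ω j => ξ j ω) P :=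
  hξ.indep.hasGaussianLaw fun j => (hξ.hasLaw j).hasGaussianLaw

/-- A product of symmetric laws is symmetric; this is what makes odd moments vanish. -/
theorem map_neg (hξ : IsComplexGaussianFamily P v ξ) :
    P.map (fun ω j => -ξ j ω) = P.map (fun ω j => ξ j ω) := by
  have hneg : iIndepFun (fun j ω => -ξ j ω) P :=
    hξ.indep.comp (fun _ z => -z) fun _ => measurable_neg
  rw [iIndepFun.map_fun_eq_pi_map (f := fun j ω => -ξ j ω)
      (fun j => (hξ.measurable j).neg.aemeasurable) hneg,
    hξ.indep.map_fun_eq_pi_map fun j => (hξ.measurable j).aemeasurable]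
  congr 1
  funext j
  rw [(hξ.hasLaw j).map_eq, ← complexGaussian_map_neg (v j), ← (hξ.hasLaw j).map_eq,
    Measure.map_map (by fun_prop) (hξ.measurable j)]
  rfl

/-- Odd functions of the family integrate to zero. -/
theorem integral_odd (hξ : IsComplexGaussianFamily P v ξ) {f : (J → ℂ) → ℝ}
    (hf : Measurable f) (hodd : ∀ x, f (-x) = -f x) :
    ∫ ω, f (fun j => ξ j ω) ∂P = 0 := by
  have h1 : ∫ ω, f (fun j => ξ j ω) ∂P = ∫ x, f x ∂(P.map fun ω j => ξ j ω) :=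
    (integral_map hξ.vecMeasurable.aemeasurable hf.aestronglyMeasurable).symm
  have h2 : ∫ ω, f (fun j => -ξ j ω) ∂P = ∫ x, f x ∂(P.map fun ω j => -ξ j ω) :=
    (integral_map (measurable_pi_lambda _ fun j => (hξ.measurable j).neg).aemeasurable
      hf.aestronglyMeasurable).symm
  rw [hξ.map_neg, ← h1] at h2
  have h3 : ∫ ω, f (fun j => -ξ j ω) ∂P = -∫ ω, f (fun j => ξ j ω) ∂P := by
    rw [← integral_neg]
    exact integral_congr_ae (.of_forall fun ω => hodd _)
  linarith

theorem dotProduct_re_hasGaussianLaw (hξ : IsComplexGaussianFamily P v ξ) (c : J → ℂ) :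
    HasGaussianLaw (fun ω => (c ⬝ᵥ fun j => ξ j ω).re) P := by
  let T : (J → ℂ) →L[ℝ] ℝ := LinearMap.toContinuousLinearMap
    { toFun := fun x => (c ⬝ᵥ x).re
      map_add' := fun x y => by simp
      map_smul' := fun r x => by simp }
  exact hξ.hasGaussianLaw.map_fun T

variable [IsProbabilityMeasure P]

theorem dotProduct_hasAllMoments (hξ : IsComplexGaussianFamily P v ξ) (c : J → ℂ) :
    HasAllMoments P (fun ω => c ⬝ᵥ fun j => ξ j ω) :=
  HasAllMoments.sum fun j _ => (HasAllMoments.const (c j)).mul (hξ.hasAllMoments j)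

theorem integral_dotProduct (hξ : IsComplexGaussianFamily P v ξ) (c : J → ℂ) :
    ∫ ω, c ⬝ᵥ (fun j => ξ j ω) ∂P = 0 := by
  simp only [dotProduct]
  rw [integral_finsetSum _ fun j _ =>
    ((HasAllMoments.const (c j)).mul (hξ.hasAllMoments j)).integrable]
  simp [integral_const_mul, hξ.integral_eq_zero]

theorem integral_dotProduct_mul (hξ : IsComplexGaussianFamily P v ξ) (c d : J → ℂ) :
    ∫ ω, (c ⬝ᵥ fun j => ξ j ω) * (d ⬝ᵥ fun j => ξ j ω) ∂P = 0 := by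
  have e : ∀ ω, (c ⬝ᵥ fun j => ξ j ω) * (d ⬝ᵥ fun j => ξ j ω)
      = ∑ i, ∑ j, (c i * d j) * (ξ i ω * ξ j ω) := fun ω => by
    simp only [dotProduct, Finset.sum_mul_sum]
    exact Finset.sum_congr rfl fun i _ => Finset.sum_congr rfl fun j _ => by ring
  have hm : ∀ i j, HasAllMoments P (fun ω => (c i * d j) * (ξ i ω * ξ j ω)) := fun i j =>
    (HasAllMoments.const _).mul ((hξ.hasAllMoments i).mul (hξ.hasAllMoments j))
  simp only [e]
  rw [integral_finsetSum _ fun i _ => (HasAllMoments.sum fun j _ => hm i j).integrable]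
  refine Finset.sum_eq_zero fun i _ => ?_
  rw [integral_finsetSum _ fun j _ => (hm i j).integrable]
  exact Finset.sum_eq_zero fun j _ => by rw [integral_const_mul, hξ.integral_mul, mul_zero]

theorem integral_dotProduct_mul_star (hξ : IsComplexGaussianFamily P v ξ) (c d : J → ℂ) :
    ∫ ω, (c ⬝ᵥ fun j => ξ j ω) * star (d ⬝ᵥ fun j => ξ j ω) ∂P
      = ∑ j, c j * v j * star (d j) := by
  classical
  have e : ∀ ω, (c ⬝ᵥ fun j => ξ j ω) * star (d ⬝ᵥ fun j => ξ j ω)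
      = ∑ i, ∑ j, (c i * star (d j)) * (ξ i ω * star (ξ j ω)) := fun ω => by
    simp only [dotProduct, star_sum, star_mul', Finset.sum_mul_sum]
    exact Finset.sum_congr rfl fun i _ => Finset.sum_congr rfl fun j _ => by ring
  have hm : ∀ i j, HasAllMoments P (fun ω => (c i * star (d j)) * (ξ i ω * star (ξ j ω))) :=
    fun i j => (HasAllMoments.const _).mul ((hξ.hasAllMoments i).mul (hξ.hasAllMoments j).star)
  simp only [e]
  rw [integral_finsetSum _ fun i _ => (HasAllMoments.sum fun j _ => hm i j).integrable]
  refine Finset.sum_congr rfl fun i _ => ?_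
  rw [integral_finsetSum _ fun j _ => (hm i j).integrable]
  simp only [integral_const_mul, hξ.integral_mul_star, mul_ite, mul_zero, Finset.sum_ite_eq,
    Finset.mem_univ, if_true]
  ring

/-- From `Re x Re y = (Re (x y) + Re (x y*)) / 2`, where the first term has mean zero by
circularity. Real covariances are thus determined by Hermitian ones. -/
theorem integral_re_mul_re (hξ : IsComplexGaussianFamily P v ξ) (c d : J → ℂ) :
    ∫ ω, (c ⬝ᵥ fun j => ξ j ω).re * (d ⬝ᵥ fun j => ξ j ω).re ∂P
      = (∑ j, c j * v j * star (d j)).re / 2 := by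
  have hc := hξ.dotProduct_hasAllMoments c
  have hd := hξ.dotProduct_hasAllMoments d
  have e : ∀ x y : ℂ, x.re * y.re = ((x * y).re + (x * star y).re) / 2 := fun x y => by
    simp only [Complex.mul_re, Complex.star_def, Complex.conj_re, Complex.conj_im]; ring
  simp only [e]
  have h1 : ∫ ω, ((c ⬝ᵥ fun j => ξ j ω) * (d ⬝ᵥ fun j => ξ j ω)).re ∂P = 0 := by
    rw [← Complex.zero_re, ← hξ.integral_dotProduct_mul c d]
    exact integral_re (hc.mul hd).integrable
  have h2 : ∫ ω, ((c ⬝ᵥ fun j => ξ j ω) * star (d ⬝ᵥ fun j => ξ j ω)).re ∂P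
      = (∑ j, c j * v j * star (d j)).re := by
    rw [← hξ.integral_dotProduct_mul_star c d]
    exact integral_re (hc.mul hd.star).integrable
  rw [integral_div, integral_add (hc.mul hd).re.integrable (hc.mul hd.star).re.integrable, h1, h2,
    zero_add]

theorem covariance_re_re (hξ : IsComplexGaussianFamily P v ξ) (c d : J → ℂ) :
    cov[fun ω => (c ⬝ᵥ fun j => ξ j ω).re, fun ω => (d ⬝ᵥ fun j => ξ j ω).re; P]
      = (∑ j, c j * v j * star (d j)).re / 2 := by
  have hc := hξ.dotProduct_hasAllMoments c
  rw [covariance_eq_sub (hc.re 2 (by simp)) ((hξ.dotProduct_hasAllMoments d).re 2 (by simp)),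
    ← hξ.integral_re_mul_re c d]
  have : ∫ ω, (c ⬝ᵥ fun j => ξ j ω).re ∂P = 0 := by
    rw [← Complex.zero_re, ← hξ.integral_dotProduct c]
    exact integral_re hc.integrable
  rw [this, zero_mul, sub_zero]
  rfl

end IsComplexGaussianFamily

end Family

/-! ### Independence and fourth moments of linear images -/

section VectorGaussian

/-- Real functionals, which test Gaussian independence, are thereby reduced to complex linear forms,
whose Hermitian covariances are known. -/
theorem exists_dotProduct_re_eq {ι : Type*} [Fintype ι] (L : StrongDual ℝ (ι → ℂ)) :
    ∃ c : ι → ℂ, ∀ z, L z = (c ⬝ᵥ z).re := by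
  classical
  -- Since `Re (c z) = Re c Re z - Im c Im z`, the values of `L` at `1` and at `I` in coordinate `i`
  -- give `Re c` and `-Im c`.
  refine ⟨fun i => ⟨L (Pi.single i 1), -L (Pi.single i Complex.I)⟩, fun z => ?_⟩
  have hz : z = ∑ i, ((z i).re • (Pi.single i 1 : ι → ℂ)
      + (z i).im • (Pi.single i Complex.I : ι → ℂ)) := by
    funext k
    simp [Finset.sum_apply, Pi.single_apply, Finset.sum_add_distrib, Complex.re_add_im]
  conv_lhs => rw [hz]
  simp only [map_sum, map_add, map_smul, dotProduct, Complex.re_sum, Complex.mul_re, smul_eq_mul]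
  exact Finset.sum_congr rfl fun i _ => by ring

namespace IsComplexGaussianFamily

variable {Ω J ι κ : Type*} [MeasurableSpace Ω] {P : Measure Ω} [IsProbabilityMeasure P]
  [Fintype J] [Fintype ι] [Fintype κ] {v : J → ℝ≥0} {ξ : J → Ω → ℂ}

theorem sum_weighted_eq_dotProduct [DecidableEq J] (v : J → ℝ≥0) (A : Matrix ι J ℂ)
    (B : Matrix κ J ℂ) (c : ι → ℂ) (d : κ → ℂ) :
    ∑ j, (c ᵥ* A) j * v j * star ((d ᵥ* B) j)
      = c ⬝ᵥ ((A * diagonal (fun j => (v j : ℂ)) * Bᴴ) *ᵥ star d) := by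
  rw [← mulVec_mulVec, dotProduct_mulVec, ← vecMul_vecMul, ← star_vecMul]
  simp [dotProduct, vecMul_diagonal]

/-- Uncorrelated linear images of a complex Gaussian family are independent. -/
theorem indepFun_mulVec [DecidableEq J] (hξ : IsComplexGaussianFamily P v ξ) {A : Matrix ι J ℂ}
    {B : Matrix κ J ℂ} (hAB : A * diagonal (fun j => (v j : ℂ)) * Bᴴ = 0) :
    IndepFun (fun ω => A *ᵥ fun j => ξ j ω) (fun ω => B *ᵥ fun j => ξ j ω) P := by
  let T : (J → ℂ) →L[ℝ] (ι → ℂ) × (κ → ℂ) := LinearMap.toContinuousLinearMap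
    { toFun := fun x => (A *ᵥ x, B *ᵥ x)
      map_add' := fun x y => by simp [mulVec_add]
      map_smul' := fun r x => by simp [mulVec_smul] }
  refine HasGaussianLaw.indepFun_of_covariance_strongDual (hξ.hasGaussianLaw.map_fun T)
    fun L₁ L₂ => ?_
  obtain ⟨c, hc⟩ := exists_dotProduct_re_eq L₁
  obtain ⟨d, hd⟩ := exists_dotProduct_re_eq L₂
  simp only [Function.comp_def, hc, hd, dotProduct_mulVec]
  rw [hξ.covariance_re_re, sum_weighted_eq_dotProduct, hAB]
  simp

theorem re_law (hξ : IsComplexGaussianFamily P v ξ) (c : J → ℂ) :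
    P.map (fun ω => (c ⬝ᵥ fun j => ξ j ω).re)
      = gaussianReal 0 (Real.toNNReal ((∑ j, c j * v j * star (c j)).re / 2)) := by
  have hc := hξ.dotProduct_hasAllMoments c
  have h0 : ∫ ω, (c ⬝ᵥ fun j => ξ j ω).re ∂P = 0 := by
    rw [← Complex.zero_re, ← hξ.integral_dotProduct c]
    exact integral_re hc.integrable
  rw [(hξ.dotProduct_re_hasGaussianLaw c).map_eq_gaussianReal, h0,
    ← covariance_self hc.re.integrable.aemeasurable, hξ.covariance_re_re]

theorem weighted_self_re (v : J → ℝ≥0) (c : J → ℂ) :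
    ∑ j, c j * v j * star (c j) = ((∑ j, v j * ‖c j‖ ^ 2 : ℝ) : ℂ) := by
  push_cast
  refine Finset.sum_congr rfl fun j _ => ?_
  rw [← Complex.mul_conj', Complex.star_def]
  ring

theorem integral_re_pow (hξ : IsComplexGaussianFamily P v ξ) (c : J → ℂ) :
    ∫ ω, (c ⬝ᵥ fun j => ξ j ω).re ^ 2 ∂P = (∑ j, v j * ‖c j‖ ^ 2) / 2 ∧
    ∫ ω, (c ⬝ᵥ fun j => ξ j ω).re ^ 4 ∂P = 3 * ((∑ j, v j * ‖c j‖ ^ 2) / 2) ^ 2 := by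
  have hc := (hξ.dotProduct_hasAllMoments c).re.integrable.aemeasurable
  have hs : (0 : ℝ) ≤ (∑ j, v j * ‖c j‖ ^ 2) / 2 := by positivity
  have h := hξ.re_law c
  rw [weighted_self_re, Complex.ofReal_re] at h
  have key : ∀ n : ℕ, ∫ ω, (c ⬝ᵥ fun j => ξ j ω).re ^ n ∂P = ∫ x, x ^ n ∂gaussianReal 0
      (Real.toNNReal ((∑ j, v j * ‖c j‖ ^ 2) / 2)) := fun n => by
    rw [← h, integral_map hc (by fun_prop)]
  rw [key, key, integral_sq_gaussianReal, integral_pow_four_gaussianReal, Real.coe_toNNReal _ hs]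
  exact ⟨rfl, rfl⟩

/-- The second variable is the imaginary part of `c ⬝ᵥ ξ`, since `Re (-i z) = Im z`. The covariance
is half the real part of `i` times a real number, hence zero. -/
theorem indepFun_re_im (hξ : IsComplexGaussianFamily P v ξ) (c : J → ℂ) :
    IndepFun (fun ω => (c ⬝ᵥ fun j => ξ j ω).re)
      (fun ω => ((-Complex.I • c) ⬝ᵥ fun j => ξ j ω).re) P := by
  let T : (J → ℂ) →L[ℝ] ℝ × ℝ := LinearMap.toContinuousLinearMap
    { toFun := fun x => ((c ⬝ᵥ x).re, ((-Complex.I • c) ⬝ᵥ x).re)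
      map_add' := fun x y => by simp only [dotProduct_add, Complex.add_re]; rfl
      map_smul' := fun r x => by simp [dotProduct_smul] }
  refine HasGaussianLaw.indepFun_of_covariance_eq_zero (hξ.hasGaussianLaw.map_fun T) ?_
  rw [hξ.covariance_re_re]
  have : ∑ j, c j * v j * star ((-Complex.I • c) j)
      = Complex.I * ∑ j, c j * v j * star (c j) := by
    rw [Finset.mul_sum]
    exact Finset.sum_congr rfl fun j _ => by simp; ring
  rw [this, weighted_self_re, Complex.re_mul_ofReal]
  simp

/-- `E|x|⁴ = 2 (E|x|²)²` for a linear form `x` in a complex Gaussian family. -/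
theorem integral_norm_pow_four (hξ : IsComplexGaussianFamily P v ξ) (c : J → ℂ) :
    ∫ ω, ‖c ⬝ᵥ fun j => ξ j ω‖ ^ 4 ∂P = 2 * (∑ j, v j * ‖c j‖ ^ 2) ^ 2 := by
  set d : J → ℂ := -Complex.I • c with hd
  -- Expand `(U² + V²)²` with `U`, `V` independent of variance `s / 2`: the total is `(3 + 2 + 3) s²
  -- / 4 = 2 s²`.
  have e : ∀ ω, ‖c ⬝ᵥ fun j => ξ j ω‖ ^ 4 = (c ⬝ᵥ fun j => ξ j ω).re ^ 4
      + 2 * ((c ⬝ᵥ fun j => ξ j ω).re ^ 2 * (d ⬝ᵥ fun j => ξ j ω).re ^ 2)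
      + (d ⬝ᵥ fun j => ξ j ω).re ^ 4 := fun ω => by
    have h1 : (d ⬝ᵥ fun j => ξ j ω).re = (c ⬝ᵥ fun j => ξ j ω).im := by
      rw [hd, smul_dotProduct]; simp
    rw [h1, show (4 : ℕ) = 2 * 2 from rfl, pow_mul, ← Complex.normSq_eq_norm_sq,
      Complex.normSq_apply]
    ring
  have hdc : ∑ j, (v j : ℝ) * ‖d j‖ ^ 2 = ∑ j, v j * ‖c j‖ ^ 2 := by
    simp [hd]
  have hU := (hξ.dotProduct_hasAllMoments c).re
  have hV := (hξ.dotProduct_hasAllMoments d).re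
  have hUV : ∫ ω, (c ⬝ᵥ fun j => ξ j ω).re ^ 2 * (d ⬝ᵥ fun j => ξ j ω).re ^ 2 ∂P
      = (∫ ω, (c ⬝ᵥ fun j => ξ j ω).re ^ 2 ∂P) * ∫ ω, (d ⬝ᵥ fun j => ξ j ω).re ^ 2 ∂P :=
    ((hξ.indepFun_re_im c).comp (φ := fun x => x ^ 2) (ψ := fun x => x ^ 2) (by fun_prop)
      (by fun_prop)).integral_fun_mul_eq_mul_integral
      (hU.pow 1).integrable.aestronglyMeasurable (hV.pow 1).integrable.aestronglyMeasurable
  have hI := ((HasAllMoments.const (P := P) (2 : ℝ)).mul ((hU.pow 1).mul (hV.pow 1)))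
  simp only [e]
  rw [integral_add ((hU.pow 3).add hI).integrable (hV.pow 3).integrable,
    integral_add (hU.pow 3).integrable hI.integrable, integral_const_mul, hUV,
    (hξ.integral_re_pow c).1, (hξ.integral_re_pow c).2, (hξ.integral_re_pow d).1,
    (hξ.integral_re_pow d).2, hdc]
  ring

/-- Polarization: summing over the four phases `±1, ±i` cancels every term that depends on the
relative phase of `x` and `y`, leaving single fourth powers and the mixed term. -/
theorem four_point_identity (x y : ℂ) :
    ‖x + y‖ ^ 4 + ‖x - y‖ ^ 4 + ‖x + Complex.I * y‖ ^ 4 + ‖x - Complex.I * y‖ ^ 4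
      = 4 * ‖x‖ ^ 4 + 4 * ‖y‖ ^ 4 + 16 * (‖x‖ ^ 2 * ‖y‖ ^ 2) := by
  have h : ∀ z : ℂ, ‖z‖ ^ 2 = z.re ^ 2 + z.im ^ 2 := fun z => by
    rw [← Complex.normSq_eq_norm_sq, Complex.normSq_apply]; ring
  have h4 : ∀ z : ℂ, ‖z‖ ^ 4 = (z.re ^ 2 + z.im ^ 2) ^ 2 := fun z => by
    rw [← h]; ring
  simp only [h, h4, Complex.add_re, Complex.add_im, Complex.sub_re, Complex.sub_im,
    Complex.mul_re, Complex.mul_im, Complex.I_re, Complex.I_im]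
  ring

/-- `E|x|²|y|² = E|x|² E|y|² + |E x y*|²` for linear forms `x`, `y` in a complex Gaussian
family. -/
theorem integral_norm_sq_mul_norm_sq (hξ : IsComplexGaussianFamily P v ξ) (c d : J → ℂ) :
    ∫ ω, ‖c ⬝ᵥ fun j => ξ j ω‖ ^ 2 * ‖d ⬝ᵥ fun j => ξ j ω‖ ^ 2 ∂P
      = (∑ j, v j * ‖c j‖ ^ 2) * (∑ j, v j * ‖d j‖ ^ 2)
        + ‖∑ j, c j * v j * star (d j)‖ ^ 2 := by
  have hm := fun c : J → ℂ => (hξ.dotProduct_hasAllMoments c).norm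
  have h4 := hξ.integral_norm_pow_four
  have hi : ∀ c : J → ℂ, Integrable (fun ω => ‖c ⬝ᵥ fun j => ξ j ω‖ ^ 4) P :=
    fun c => ((hm c).pow 3).integrable
  have e : ∀ ω, ‖c ⬝ᵥ fun j => ξ j ω‖ ^ 2 * ‖d ⬝ᵥ fun j => ξ j ω‖ ^ 2
      = (‖(c + d) ⬝ᵥ fun j => ξ j ω‖ ^ 4 + ‖(c - d) ⬝ᵥ fun j => ξ j ω‖ ^ 4
        + ‖(c + Complex.I • d) ⬝ᵥ fun j => ξ j ω‖ ^ 4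
        + ‖(c - Complex.I • d) ⬝ᵥ fun j => ξ j ω‖ ^ 4
        - 4 * ‖c ⬝ᵥ fun j => ξ j ω‖ ^ 4 - 4 * ‖d ⬝ᵥ fun j => ξ j ω‖ ^ 4) / 16 := fun ω => by
    simp only [add_dotProduct, sub_dotProduct, smul_dotProduct, smul_eq_mul]
    rw [four_point_identity]
    ring
  simp only [e]
  rw [integral_div, integral_sub (by fun_prop) (by fun_prop),
    integral_sub (by fun_prop) (by fun_prop), integral_add (by fun_prop) (by fun_prop),
    integral_add (by fun_prop) (by fun_prop), integral_add (by fun_prop) (by fun_prop),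
    integral_const_mul, integral_const_mul]
  simp only [h4]
  have hr : ∀ z : ℂ, ‖z‖ ^ 2 = z.re ^ 2 + z.im ^ 2 := fun z => by
    rw [← Complex.normSq_eq_norm_sq, Complex.normSq_apply]; ring
  set r := ∑ j, c j * v j * star (d j) with hrdef
  set sc := ∑ j, (v j : ℝ) * ‖c j‖ ^ 2 with hsc
  set sd := ∑ j, (v j : ℝ) * ‖d j‖ ^ 2 with hsd
  have hrre : r.re = ∑ j, v j * ((c j).re * (d j).re + (c j).im * (d j).im) := by
    rw [hrdef, Complex.re_sum]
    exact Finset.sum_congr rfl fun j _ => by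
      simp only [Complex.mul_re, Complex.mul_im, Complex.star_def, Complex.conj_re,
        Complex.conj_im, Complex.ofReal_re, Complex.ofReal_im]
      ring
  have hrim : r.im = ∑ j, v j * ((c j).im * (d j).re - (c j).re * (d j).im) := by
    rw [hrdef, Complex.im_sum]
    exact Finset.sum_congr rfl fun j _ => by
      simp only [Complex.mul_re, Complex.mul_im, Complex.star_def, Complex.conj_re,
        Complex.conj_im, Complex.ofReal_re, Complex.ofReal_im]
      ring
  -- The four combinations have variances `sc + sd ± 2 Re r` and `sc + sd ± 2 Im r`. Twice the sum
  -- of their squares is `8 (sc + sd)² + 16 |r|²`, which yields the claim after subtracting `8 sc² +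
  -- 8 sd²` and dividing by `16`.
  have e1 : ∑ j, (v j : ℝ) * ‖(c + d) j‖ ^ 2 = sc + sd + 2 * r.re := by
    rw [hrre, hsc, hsd, Finset.mul_sum, ← Finset.sum_add_distrib, ← Finset.sum_add_distrib]
    exact Finset.sum_congr rfl fun j _ => by simp [hr]; ring
  have e2 : ∑ j, (v j : ℝ) * ‖(c - d) j‖ ^ 2 = sc + sd - 2 * r.re := by
    rw [hrre, hsc, hsd, Finset.mul_sum, ← Finset.sum_add_distrib, ← Finset.sum_sub_distrib]
    exact Finset.sum_congr rfl fun j _ => by simp [hr]; ring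
  have e3 : ∑ j, (v j : ℝ) * ‖(c + Complex.I • d) j‖ ^ 2 = sc + sd + 2 * r.im := by
    rw [hrim, hsc, hsd, Finset.mul_sum, ← Finset.sum_add_distrib, ← Finset.sum_add_distrib]
    exact Finset.sum_congr rfl fun j _ => by simp [hr]; ring
  have e4 : ∑ j, (v j : ℝ) * ‖(c - Complex.I • d) j‖ ^ 2 = sc + sd - 2 * r.im := by
    rw [hrim, hsc, hsd, Finset.mul_sum, ← Finset.sum_add_distrib, ← Finset.sum_sub_distrib]
    exact Finset.sum_congr rfl fun j _ => by simp [hr]; ring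
  rw [e1, e2, e3, e4, hr r]
  ring

end IsComplexGaussianFamily

end VectorGaussian

/-! ### Moments of complex Gaussian vectors -/

section GaussianVectors

namespace IsComplexGaussianFamily

variable {Ω J : Type*} [MeasurableSpace Ω] {P : Measure Ω} [IsProbabilityMeasure P]
  [Fintype J] {v : J → ℝ≥0} {ξ : J → Ω → ℂ} {m n : ℕ}

theorem affine_hasAllMoments (hξ : IsComplexGaussianFamily P v ξ) (μ : Fin m → ℂ)
    (A : Matrix (Fin m) J ℂ) (i : Fin m) :
    HasAllMoments P (fun ω => (μ + A *ᵥ fun j => ξ j ω) i) :=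
  (HasAllMoments.const (μ i)).add (hξ.dotProduct_hasAllMoments (A i))

theorem meanVec_affine (hξ : IsComplexGaussianFamily P v ξ) (μ : Fin m → ℂ)
    (A : Matrix (Fin m) J ℂ) : meanVec P (fun ω => μ + A *ᵥ fun j => ξ j ω) = μ := by
  funext i
  change ∫ ω, μ i + (A i ⬝ᵥ fun j => ξ j ω) ∂P = μ i
  rw [integral_add (integrable_const _) (hξ.dotProduct_hasAllMoments _).integrable,
    hξ.integral_dotProduct]
  simp

theorem mul_diagonal_mul_conjTranspose_apply [DecidableEq J] (v : J → ℝ≥0)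
    (A : Matrix (Fin m) J ℂ) (B : Matrix (Fin n) J ℂ) (i : Fin m) (k : Fin n) :
    (A * diagonal (fun j => (v j : ℂ)) * Bᴴ) i k = ∑ j, A i j * v j * star (B k j) := by
  rw [Matrix.mul_apply]
  simp only [mul_diagonal, conjTranspose_apply]

theorem crossMoment_mulVec [DecidableEq J] (hξ : IsComplexGaussianFamily P v ξ)
    (A : Matrix (Fin m) J ℂ) (B : Matrix (Fin n) J ℂ) :
    crossMoment P (fun ω => A *ᵥ fun j => ξ j ω) (fun ω => B *ᵥ fun j => ξ j ω)
      = A * diagonal (fun j => (v j : ℂ)) * Bᴴ := by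
  ext i k
  rw [mul_diagonal_mul_conjTranspose_apply]
  exact hξ.integral_dotProduct_mul_star (A i) (B k)

theorem crossCov_affine [DecidableEq J] (hξ : IsComplexGaussianFamily P v ξ) (μ : Fin m → ℂ)
    (μ' : Fin n → ℂ) (A : Matrix (Fin m) J ℂ) (B : Matrix (Fin n) J ℂ) :
    crossCov P (fun ω => μ + A *ᵥ fun j => ξ j ω) (fun ω => μ' + B *ᵥ fun j => ξ j ω)
      = A * diagonal (fun j => (v j : ℂ)) * Bᴴ := by
  rw [crossCov, hξ.meanVec_affine, hξ.meanVec_affine]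
  simp only [add_sub_cancel_left]
  exact hξ.crossMoment_mulVec A B

theorem crossMoment_affine_self [DecidableEq J] (hξ : IsComplexGaussianFamily P v ξ)
    (μ : Fin m → ℂ) (A : Matrix (Fin m) J ℂ) :
    crossMoment P (fun ω => μ + A *ᵥ fun j => ξ j ω) (fun ω => μ + A *ᵥ fun j => ξ j ω)
      = A * diagonal (fun j => (v j : ℂ)) * Aᴴ + vecMulVec μ (star μ) := by
  rw [← hξ.crossMoment_mulVec]
  ext i k
  change ∫ ω, (μ i + (A i ⬝ᵥ fun j => ξ j ω)) * star (μ k + (A k ⬝ᵥ fun j => ξ j ω)) ∂P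
    = (∫ ω, (A i ⬝ᵥ fun j => ξ j ω) * star (A k ⬝ᵥ fun j => ξ j ω) ∂P) + μ i * star (μ k)
  have hi := hξ.dotProduct_hasAllMoments (A i)
  have hk := hξ.dotProduct_hasAllMoments (A k)
  have hc := fun z : ℂ => HasAllMoments.const (P := P) z
  have hstar : ∫ ω, star (A k ⬝ᵥ fun j => ξ j ω) ∂P = 0 := by
    have : ∫ ω, star (A k ⬝ᵥ fun j => ξ j ω) ∂P = star (∫ ω, A k ⬝ᵥ fun j => ξ j ω ∂P) :=
      integral_conj
    rw [this, hξ.integral_dotProduct, star_zero]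
  have e : ∀ ω, (μ i + (A i ⬝ᵥ fun j => ξ j ω)) * star (μ k + (A k ⬝ᵥ fun j => ξ j ω))
      = (A i ⬝ᵥ fun j => ξ j ω) * star (A k ⬝ᵥ fun j => ξ j ω)
        + μ i * star (A k ⬝ᵥ fun j => ξ j ω) + star (μ k) * (A i ⬝ᵥ fun j => ξ j ω)
        + μ i * star (μ k) := fun ω => by rw [star_add]; ring
  simp only [e]
  rw [integral_add ((((hi.mul hk.star).add ((hc _).mul hk.star)).add ((hc _).mul hi)).integrable)
      (integrable_const _),
    integral_add ((hi.mul hk.star).add ((hc _).mul hk.star)).integrable ((hc _).mul hi).integrable,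
    integral_add (hi.mul hk.star).integrable ((hc _).mul hk.star).integrable,
    integral_const_mul, integral_const_mul, hstar, hξ.integral_dotProduct]
  simp

/-- Hermitian symmetry turns `C i j * C j i` into `|C i j|²`, the form in which the pairwise fourth
moments produce it. -/
theorem trace_sq_re_of_isHermitian {C : Matrix (Fin m) (Fin m) ℂ} (hC : C.IsHermitian) :
    (C ^ 2).trace.re = ∑ i, ∑ j, ‖C i j‖ ^ 2 := by
  rw [sq, Matrix.trace, Complex.re_sum]
  refine Finset.sum_congr rfl fun i _ => ?_
  rw [Matrix.diag_apply, Matrix.mul_apply, Complex.re_sum]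
  refine Finset.sum_congr rfl fun j _ => ?_
  rw [← hC.apply j i, Complex.star_def, Complex.mul_conj']
  norm_cast

theorem isHermitian_mul_diagonal [DecidableEq J] (v : J → ℝ≥0) (A : Matrix (Fin m) J ℂ) :
    (A * diagonal (fun j => (v j : ℂ)) * Aᴴ).IsHermitian := by
  refine isHermitian_mul_mul_conjTranspose A ?_
  rw [Matrix.IsHermitian, diagonal_conjTranspose]
  congr 1
  funext j
  simp

theorem posSemidef_mul_diagonal [DecidableEq J] (v : J → ℝ≥0) (A : Matrix (Fin m) J ℂ) :
    (A * diagonal (fun j => (v j : ℂ)) * Aᴴ).PosSemidef :=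
  (PosSemidef.diagonal fun j => by simp).mul_mul_conjTranspose_same A

/-- First and second moments of the squared norm of a complex Gaussian vector with mean `μ` and
covariance `C`. -/
theorem integral_norm_sq_affine [DecidableEq J] (hξ : IsComplexGaussianFamily P v ξ)
    (μ : Fin m → ℂ) (A : Matrix (Fin m) J ℂ) {C : Matrix (Fin m) (Fin m) ℂ}
    (hC : C = A * diagonal (fun j => (v j : ℂ)) * Aᴴ) :
    ∫ ω, ‖WithLp.toLp 2 (μ + A *ᵥ fun j => ξ j ω)‖ ^ 2 ∂P
      = C.trace.re + ‖WithLp.toLp 2 μ‖ ^ 2 ∧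
    ∫ ω, (‖WithLp.toLp 2 (μ + A *ᵥ fun j => ξ j ω)‖ ^ 2) ^ 2 ∂P
      = (C.trace.re + ‖WithLp.toLp 2 μ‖ ^ 2) ^ 2 + (C ^ 2).trace.re
        + 2 * (star μ ⬝ᵥ (C *ᵥ μ)).re := by
  have hx := fun i => hξ.dotProduct_hasAllMoments (A i)
  set c : J → ℂ := star μ ᵥ* A with hcdef
  have hT := (hξ.dotProduct_hasAllMoments c).re
  set S : Ω → ℝ := fun ω => ∑ i, ‖A i ⬝ᵥ fun j => ξ j ω‖ ^ 2 with hSdef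
  have hS : HasAllMoments P S := HasAllMoments.sum fun i _ => (hx i).norm.pow 1
  set a : ℝ := ‖WithLp.toLp 2 μ‖ ^ 2 with hadef
  -- For the centred part `x`, this is `‖μ + x‖² = a + 2 T + S` with `T = Re μ^H x` and `S = ‖x‖²`;
  -- both claims reduce to moments of `T` and `S` up to order two.
  have e : ∀ ω, ‖WithLp.toLp 2 (μ + A *ᵥ fun j => ξ j ω)‖ ^ 2
      = a + 2 * (c ⬝ᵥ fun j => ξ j ω).re + S ω := fun ω => by
    rw [hadef, EuclideanSpace.norm_sq_eq, EuclideanSpace.norm_sq_eq, hcdef, ← dotProduct_mulVec,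
      dotProduct, Complex.re_sum, Finset.mul_sum, ← Finset.sum_add_distrib, hSdef,
      ← Finset.sum_add_distrib]
    refine Finset.sum_congr rfl fun i _ => ?_
    change ‖μ i + (A i ⬝ᵥ fun j => ξ j ω)‖ ^ 2 = ‖μ i‖ ^ 2
      + 2 * (star (μ i) * (A i ⬝ᵥ fun j => ξ j ω)).re + ‖A i ⬝ᵥ fun j => ξ j ω‖ ^ 2
    generalize (A i ⬝ᵥ fun j => ξ j ω) = z
    simp only [← Complex.normSq_eq_norm_sq, Complex.normSq_apply, Complex.add_re, Complex.add_im,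
      Complex.mul_re, Complex.star_def, Complex.conj_re, Complex.conj_im]
    ring
  have hCii : ∀ i, C i i = ((∑ j, (v j : ℝ) * ‖A i j‖ ^ 2 : ℝ) : ℂ) := fun i => by
    rw [hC, mul_diagonal_mul_conjTranspose_apply, weighted_self_re]
  have hCtr : C.trace.re = ∑ i, ∑ j, (v j : ℝ) * ‖A i j‖ ^ 2 := by
    simp only [Matrix.trace, Matrix.diag_apply, hCii, ← Complex.ofReal_sum, Complex.ofReal_re]
  have iT : ∫ ω, (c ⬝ᵥ fun j => ξ j ω).re ∂P = 0 := by
    rw [← Complex.zero_re, ← hξ.integral_dotProduct c]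
    exact integral_re (hξ.dotProduct_hasAllMoments c).integrable
  have iTT : ∫ ω, (c ⬝ᵥ fun j => ξ j ω).re * (c ⬝ᵥ fun j => ξ j ω).re ∂P
      = (star μ ⬝ᵥ (C *ᵥ μ)).re / 2 := by
    rw [hξ.integral_re_mul_re, hcdef, sum_weighted_eq_dotProduct, ← hC, star_star]
  have iS : ∫ ω, S ω ∂P = C.trace.re := by
    rw [hSdef, integral_finsetSum _ fun i _ => ((hx i).norm.pow 1).integrable, hCtr]
    refine Finset.sum_congr rfl fun i _ => ?_
    have h1 := hξ.integral_dotProduct_mul_star (A i) (A i)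
    rw [weighted_self_re] at h1
    rw [← Complex.ofReal_inj, ← h1, ← integral_complex_ofReal]
    refine integral_congr_ae (.of_forall fun ω => ?_)
    simp [Complex.mul_conj']
  -- Summing the mixed fourth moment over pairs of coordinates, the product terms give `(tr C)²` and
  -- the correlation terms `∑ |C i k|² = tr C²`.
  have iSS : ∫ ω, S ω * S ω ∂P = C.trace.re ^ 2 + (C ^ 2).trace.re := by
    have hp := fun i k => ((hx i).norm.pow 1).mul ((hx k).norm.pow 1)
    simp only [hSdef, Finset.sum_mul_sum]
    rw [integral_finsetSum _ fun i _ => (HasAllMoments.sum fun k _ => hp i k).integrable,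
      trace_sq_re_of_isHermitian (hC ▸ isHermitian_mul_diagonal v A), hCtr, sq,
      Finset.sum_mul_sum, ← Finset.sum_add_distrib]
    refine Finset.sum_congr rfl fun i _ => ?_
    rw [integral_finsetSum _ fun k _ => (hp i k).integrable, ← Finset.sum_add_distrib]
    refine Finset.sum_congr rfl fun k _ => ?_
    rw [hC, mul_diagonal_mul_conjTranspose_apply]
    exact hξ.integral_norm_sq_mul_norm_sq (A i) (A k)
  -- The product is odd of degree three in the family.
  have iTS : ∫ ω, (c ⬝ᵥ fun j => ξ j ω).re * S ω ∂P = 0 := by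
    refine hξ.integral_odd (f := fun x => (c ⬝ᵥ x).re * ∑ i, ‖A i ⬝ᵥ x‖ ^ 2) ?_ fun x => ?_
    · unfold dotProduct; fun_prop
    · simp
  have hc := fun r : ℝ => HasAllMoments.const (P := P) r
  constructor
  · simp only [e]
    rw [integral_add ((hc a).add ((hc 2).mul hT)).integrable hS.integrable,
      integral_add (hc a).integrable ((hc 2).mul hT).integrable, integral_const_mul, iT, iS]
    simp
    ring
  · have e2 : ∀ ω, (‖WithLp.toLp 2 (μ + A *ᵥ fun j => ξ j ω)‖ ^ 2) ^ 2
        = a ^ 2 + 4 * ((c ⬝ᵥ fun j => ξ j ω).re * (c ⬝ᵥ fun j => ξ j ω).re) + S ω * S ω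
          + (4 * a) * (c ⬝ᵥ fun j => ξ j ω).re + (2 * a) * S ω
          + 4 * ((c ⬝ᵥ fun j => ξ j ω).re * S ω) := fun ω => by rw [e]; ring
    have i1 := (hc (a ^ 2))
    have i2 := ((hc 4).mul (hT.mul hT))
    have i3 := (hS.mul hS)
    have i4 := ((hc (4 * a)).mul hT)
    have i5 := ((hc (2 * a)).mul hS)
    have i6 := ((hc 4).mul (hT.mul hS))
    simp only [e2]
    rw [integral_add ((((i1.add i2).add i3).add i4).add i5).integrable i6.integrable,
      integral_add (((i1.add i2).add i3).add i4).integrable i5.integrable,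
      integral_add ((i1.add i2).add i3).integrable i4.integrable,
      integral_add (i1.add i2).integrable i3.integrable, integral_add i1.integrable i2.integrable]
    simp only [integral_const_mul, iT, iTT, iS, iSS, iTS]
    simp
    ring

end IsComplexGaussianFamily

end GaussianVectors

/-! ### Inner products and conditioning of independent vectors -/

section IndependentVectors

variable {Ω : Type*} [MeasurableSpace Ω] {P : Measure Ω} {m : ℕ}

theorem ofReal_norm_sq_eq_star_dotProduct (x : Fin m → ℂ) :
    ((‖WithLp.toLp 2 x‖ ^ 2 : ℝ) : ℂ) = star x ⬝ᵥ x := by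
  rw [EuclideanSpace.norm_sq_eq, Complex.ofReal_sum]
  refine Finset.sum_congr rfl fun i _ => ?_
  simp [Complex.conj_mul']

theorem hasAllMoments_star_dotProduct {u w : Ω → Fin m → ℂ}
    (hu : ∀ i, HasAllMoments P (fun ω => u ω i)) (hw : ∀ i, HasAllMoments P (fun ω => w ω i)) :
    HasAllMoments P (fun ω => star (w ω) ⬝ᵥ u ω) :=
  HasAllMoments.sum fun i _ => (hw i).star.mul (hu i)

theorem hasAllMoments_norm_sq {w : Ω → Fin m → ℂ}
    (hw : ∀ i, HasAllMoments P (fun ω => w ω i)) :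
    HasAllMoments P (fun ω => ‖WithLp.toLp 2 (w ω)‖ ^ 2) := by
  simp only [EuclideanSpace.norm_sq_eq]
  exact HasAllMoments.sum fun i _ => (hw i).norm.pow 1

/-- `E|w^H u|² = tr(E[u u^H] E[w w^H])` for independent `u` and `w`. -/
theorem integral_norm_sq_star_dotProduct_of_indepFun {u w : Ω → Fin m → ℂ}
    (hu : ∀ i, HasAllMoments P (fun ω => u ω i)) (hw : ∀ i, HasAllMoments P (fun ω => w ω i))
    (h : IndepFun u w P) :
    ∫ ω, ‖star (w ω) ⬝ᵥ u ω‖ ^ 2 ∂P = (crossMoment P u u * crossMoment P w w).trace.re := by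
  rw [← Complex.ofReal_re (∫ ω, ‖star (w ω) ⬝ᵥ u ω‖ ^ 2 ∂P), ← integral_complex_ofReal]
  congr 1
  have e : ∀ ω, ((‖star (w ω) ⬝ᵥ u ω‖ ^ 2 : ℝ) : ℂ)
      = ∑ i, ∑ j, (u ω i * star (u ω j)) * (w ω j * star (w ω i)) := fun ω => by
    push_cast
    rw [← Complex.mul_conj', ← Complex.star_def, dotProduct, star_sum, Finset.sum_mul_sum]
    refine Finset.sum_congr rfl fun i _ => Finset.sum_congr rfl fun j _ => ?_
    simp only [Pi.star_apply, star_mul', star_star]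
    ring
  have hp := fun i j => ((hu i).mul (hu j).star).mul ((hw j).mul (hw i).star)
  simp only [e]
  rw [integral_finsetSum _ fun i _ => (HasAllMoments.sum fun j _ => hp i j).integrable,
    Matrix.trace]
  refine Finset.sum_congr rfl fun i _ => ?_
  rw [integral_finsetSum _ fun j _ => (hp i j).integrable, Matrix.diag_apply, Matrix.mul_apply]
  refine Finset.sum_congr rfl fun j _ => ?_
  exact (h.comp (φ := fun x : Fin m → ℂ => x i * star (x j))
    (ψ := fun x : Fin m → ℂ => x j * star (x i)) (by fun_prop)
    (by fun_prop)).integral_fun_mul_eq_mul_integral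
      ((hu i).mul (hu j).star).integrable.aestronglyMeasurable
      ((hw j).mul (hw i).star).integrable.aestronglyMeasurable

/-- Each entry of `e` meets a factor depending on `w` alone, so its zero mean splits off. The weight
`φ` is `1` for the mean gain and `‖·‖²` for the cross term of its second moment. -/
theorem integral_mul_star_dotProduct_of_indepFun {e w : Ω → Fin m → ℂ}
    (he : ∀ i, HasAllMoments P (fun ω => e ω i)) (hw : ∀ i, HasAllMoments P (fun ω => w ω i))
    (h : IndepFun e w P) (h0 : ∀ i, ∫ ω, e ω i ∂P = 0) {φ : (Fin m → ℂ) → ℂ} (hφ : Measurable φ)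
    (hφw : HasAllMoments P (fun ω => φ (w ω))) :
    ∫ ω, φ (w ω) * (star (w ω) ⬝ᵥ e ω) ∂P = 0 := by
  have e1 : ∀ ω, φ (w ω) * (star (w ω) ⬝ᵥ e ω)
      = ∑ i, e ω i * (φ (w ω) * star (w ω i)) := fun ω => by
    rw [dotProduct, Finset.mul_sum]
    exact Finset.sum_congr rfl fun i _ => by simp only [Pi.star_apply]; ring
  have hp := fun i => (hφw.mul (hw i).star)
  simp only [e1]
  rw [integral_finsetSum _ fun i _ => ((he i).mul (hp i)).integrable]
  refine Finset.sum_eq_zero fun i _ => ?_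
  have := (h.comp (φ := fun x : Fin m → ℂ => x i)
    (ψ := fun x : Fin m → ℂ => φ x * star (x i)) (by fun_prop)
    (by fun_prop)).integral_fun_mul_eq_mul_integral
      (he i).integrable.aestronglyMeasurable (hp i).integrable.aestronglyMeasurable
  refine this.trans ?_
  change (∫ ω, e ω i ∂P) * _ = 0
  rw [h0, zero_mul]

variable [IsProbabilityMeasure P]

theorem integral_star_dotProduct_add {e w : Ω → Fin m → ℂ}
    (he : ∀ i, HasAllMoments P (fun ω => e ω i)) (hw : ∀ i, HasAllMoments P (fun ω => w ω i))
    (h : IndepFun e w P) (h0 : ∀ i, ∫ ω, e ω i ∂P = 0) :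
    ∫ ω, star (w ω) ⬝ᵥ (w ω + e ω) ∂P = ((∫ ω, ‖WithLp.toLp 2 (w ω)‖ ^ 2 ∂P : ℝ) : ℂ) := by
  have hz := integral_mul_star_dotProduct_of_indepFun he hw h h0 (φ := fun _ => 1)
    measurable_const (HasAllMoments.const _)
  simp only [one_mul] at hz
  simp only [dotProduct_add]
  rw [integral_add (hasAllMoments_star_dotProduct hw hw).integrable
    (hasAllMoments_star_dotProduct he hw).integrable, hz, add_zero, ← integral_complex_ofReal]
  simp only [ofReal_norm_sq_eq_star_dotProduct]

/-- `E|w^H (w + e)|² = E‖w‖⁴ + tr(E[e e^H] E[w w^H])` when `e` is centred and independent of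
`w`. -/
theorem integral_norm_sq_star_dotProduct_add {e w : Ω → Fin m → ℂ}
    (he : ∀ i, HasAllMoments P (fun ω => e ω i)) (hw : ∀ i, HasAllMoments P (fun ω => w ω i))
    (h : IndepFun e w P) (h0 : ∀ i, ∫ ω, e ω i ∂P = 0) :
    ∫ ω, ‖star (w ω) ⬝ᵥ (w ω + e ω)‖ ^ 2 ∂P
      = ∫ ω, (‖WithLp.toLp 2 (w ω)‖ ^ 2) ^ 2 ∂P
        + (crossMoment P e e * crossMoment P w w).trace.re := by
  have hwe := hasAllMoments_star_dotProduct he hw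
  have hww := hasAllMoments_norm_sq hw
  have hp := hww.ofReal.mul hwe
  have hz := integral_mul_star_dotProduct_of_indepFun he hw h h0
    (φ := fun x => ((‖WithLp.toLp 2 x‖ ^ 2 : ℝ) : ℂ)) (by fun_prop) hww.ofReal
  have hzr : ∫ ω, (((‖WithLp.toLp 2 (w ω)‖ ^ 2 : ℝ) : ℂ) * (star (w ω) ⬝ᵥ e ω)).re ∂P = 0 := by
    rw [← Complex.zero_re, ← hz]
    exact integral_re hp.integrable
  -- With `t = ‖w‖²` real and `z = w^H e`, this is `|t + z|² = t² + 2 Re (t z) + |z|²`; the middle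
  -- term has mean zero.
  have e1 : ∀ ω, ‖star (w ω) ⬝ᵥ (w ω + e ω)‖ ^ 2
      = (‖WithLp.toLp 2 (w ω)‖ ^ 2) ^ 2
        + 2 * (((‖WithLp.toLp 2 (w ω)‖ ^ 2 : ℝ) : ℂ) * (star (w ω) ⬝ᵥ e ω)).re
        + ‖star (w ω) ⬝ᵥ e ω‖ ^ 2 := fun ω => by
    rw [dotProduct_add, ← ofReal_norm_sq_eq_star_dotProduct]
    generalize star (w ω) ⬝ᵥ e ω = z
    generalize ‖WithLp.toLp 2 (w ω)‖ ^ 2 = t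
    simp only [← Complex.normSq_eq_norm_sq, Complex.normSq_apply, Complex.add_re, Complex.add_im,
      Complex.mul_re, Complex.ofReal_re, Complex.ofReal_im]
    ring
  simp only [e1]
  rw [integral_add ((hww.pow 1).add ((HasAllMoments.const 2).mul hp.re)).integrable
      (hwe.norm.pow 1).integrable,
    integral_add (hww.pow 1).integrable ((HasAllMoments.const 2).mul hp.re).integrable,
    integral_const_mul, hzr, integral_norm_sq_star_dotProduct_of_indepFun he hw h]
  ring

/-- If `x = f(y) + e` with `e` centred and independent of `y`, then `E[x | y] = f(y)`. -/
theorem condExp_comap_eq_of_indepFun {E F : Type*} [NormedAddCommGroup E] [NormedSpace ℝ E]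
    [CompleteSpace E] [MeasurableSpace E] [BorelSpace E] [SecondCountableTopology E]
    [MeasurableSpace F] {e : Ω → E} {y : Ω → F} {f : F → E} (hy : Measurable y)
    (hem : Measurable e) (he : Integrable e P) (h0 : ∫ ω, e ω ∂P = 0) (hf : Measurable f)
    (hfy : Integrable (fun ω => f (y ω)) P) (h : IndepFun e y P) :
    P[fun ω => f (y ω) + e ω | MeasurableSpace.comap y inferInstance]
      =ᵐ[P] fun ω => f (y ω) := by
  have h1 : P[fun ω => f (y ω) | MeasurableSpace.comap y inferInstance] = fun ω => f (y ω) :=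
    condExp_of_stronglyMeasurable hy.comap_le
      (hf.comp (comap_measurable y)).stronglyMeasurable hfy
  have h2 : P[e | MeasurableSpace.comap y inferInstance] =ᵐ[P] fun _ => ∫ ω, e ω ∂P :=
    condExp_indep_eq hem.comap_le hy.comap_le (comap_measurable e).stronglyMeasurable h
  filter_upwards [condExp_add hfy he (MeasurableSpace.comap y inferInstance), h2] with ω a b
  refine a.trans ?_
  rw [Pi.add_apply, h1, b, h0, add_zero]

end IndependentVectors

/-! ### Matrix algebra of the LMMSE estimate -/

section LinearEstimation

variable {N : ℕ} {R : Matrix (Fin N) (Fin N) ℂ} {t s : ℝ}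

/-- The noise term makes the observation covariance invertible even when `R` is singular or the
pilot power is zero. -/
theorem posDef_smul_add_smul_one (hR : R.PosSemidef) (ht : 0 ≤ t) (hs : 0 < s) :
    ((t : ℂ) • R + (s : ℂ) • (1 : Matrix (Fin N) (Fin N) ℂ)).PosDef :=
  (PosDef.one.smul (by exact_mod_cast hs)).posSemidef_add (hR.smul (by exact_mod_cast ht))

theorem mul_inv_comm_of_smul_add_smul_one (hR : R.PosSemidef) (ht : 0 ≤ t) (hs : 0 < s) :
    R * ((t : ℂ) • R + (s : ℂ) • 1)⁻¹ = ((t : ℂ) • R + (s : ℂ) • 1)⁻¹ * R := by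
  set M := (t : ℂ) • R + (s : ℂ) • (1 : Matrix (Fin N) (Fin N) ℂ) with hM
  have hu : IsUnit M.det := (posDef_smul_add_smul_one hR ht hs).isUnit.map detMonoidHom
  have hc : R * M = M * R := by simp [hM, mul_add, add_mul]
  calc R * M⁻¹ = M⁻¹ * M * (R * M⁻¹) := by rw [nonsing_inv_mul _ hu, one_mul]
    _ = M⁻¹ * (M * R) * M⁻¹ := by simp only [Matrix.mul_assoc]
    _ = M⁻¹ * R := by rw [← hc, ← Matrix.mul_assoc, mul_nonsing_inv_cancel_right _ _ hu]

/-- The two closed forms of the error covariance agree. -/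
theorem sub_smul_mul_inv_mul_eq (hR : R.PosSemidef) (ht : 0 ≤ t) (hs : 0 < s) :
    R - (t : ℂ) • (R * ((t : ℂ) • R + (s : ℂ) • 1)⁻¹ * R)
      = R * (1 + ((t / s : ℝ) : ℂ) • R)⁻¹ := by
  set M := (t : ℂ) • R + (s : ℂ) • (1 : Matrix (Fin N) (Fin N) ℂ) with hM
  have hu : IsUnit M.det := (posDef_smul_add_smul_one hR ht hs).isUnit.map detMonoidHom
  have hs' : (s : ℂ) ≠ 0 := by exact_mod_cast hs.ne'
  have h1 : (1 + ((t / s : ℝ) : ℂ) • R)⁻¹ = (s : ℂ) • M⁻¹ := by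
    refine inv_eq_right_inv ?_
    have : (s : ℂ) • (1 + ((t / s : ℝ) : ℂ) • R) = M := by
      rw [hM, smul_add, smul_smul, add_comm]
      push_cast
      rw [mul_div_cancel₀ _ hs']
    rw [Matrix.mul_smul, ← Matrix.smul_mul, this, mul_nonsing_inv _ hu]
  -- With `t R = M - s I`, the left side becomes `R - R M⁻¹ (M - s I) = s R M⁻¹`.
  have h2 : (t : ℂ) • R = M - (s : ℂ) • 1 := by rw [hM, add_sub_cancel_right]
  rw [h1, ← Matrix.mul_smul, h2, Matrix.mul_sub, Matrix.mul_assoc R,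
    Matrix.nonsing_inv_mul _ hu]
  simp

/-- Covariances of the LMMSE estimate `G y` and of its error `h - G y` in the model
`y = r h + noise`, written with linear maps `H` and `Y` of a common source of covariance `D`. -/
theorem lmmse_covariances {J : Type*} [Fintype J] {D : Matrix J J ℂ} {H Y : Matrix (Fin N) J ℂ}
    {r : ℝ} (hR : R.PosSemidef) (ht : 0 ≤ t) (hs : 0 < s) (hr : r * r = t)
    (hHH : H * D * Hᴴ = R) (hHY : H * D * Yᴴ = (r : ℂ) • R) (hYH : Y * D * Hᴴ = (r : ℂ) • R)
    (hYY : Y * D * Yᴴ = (t : ℂ) • R + (s : ℂ) • 1) {G : Matrix (Fin N) (Fin N) ℂ}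
    (hG : G = (r : ℂ) • (R * ((t : ℂ) • R + (s : ℂ) • 1)⁻¹)) :
    (G * Y) * D * (G * Y)ᴴ = (t : ℂ) • (R * ((t : ℂ) • R + (s : ℂ) • 1)⁻¹ * R) ∧
    (H - G * Y) * D * Yᴴ = 0 ∧
    (H - G * Y) * D * (H - G * Y)ᴴ = R - (G * Y) * D * (G * Y)ᴴ := by
  have hu : IsUnit ((t : ℂ) • R + (s : ℂ) • (1 : Matrix (Fin N) (Fin N) ℂ)).det :=
    (posDef_smul_add_smul_one hR ht hs).isUnit.map detMonoidHom
  have hMH := (posDef_smul_add_smul_one hR ht hs).isHermitian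
  have hcomm := mul_inv_comm_of_smul_add_smul_one hR ht hs
  set M := (t : ℂ) • R + (s : ℂ) • (1 : Matrix (Fin N) (Fin N) ℂ) with hM
  have hrt : (r : ℂ) * r = t := by exact_mod_cast hr
  have hGM : G * M = (r : ℂ) • R := by
    rw [hG, Matrix.smul_mul, Matrix.mul_assoc, nonsing_inv_mul _ hu, Matrix.mul_one]
  have hGH : Gᴴ = (r : ℂ) • (M⁻¹ * R) := by
    rw [hG, conjTranspose_smul, conjTranspose_mul, hR.isHermitian.eq, hMH.inv.eq]
    simp
  have h1 : (G * Y) * D * (G * Y)ᴴ = (t : ℂ) • (R * M⁻¹ * R) := by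
    have : (G * Y) * D * (G * Y)ᴴ = G * (Y * D * Yᴴ) * Gᴴ := by
      rw [conjTranspose_mul]; simp only [Matrix.mul_assoc]
    rw [this, hYY, hGM, hGH, Matrix.smul_mul, Matrix.mul_smul, smul_smul, hrt, Matrix.mul_assoc]
  -- Orthogonality principle: `G` solves `G C_y = C_hy`.
  have h2 : (H - G * Y) * D * Yᴴ = 0 := by
    have : (H - G * Y) * D * Yᴴ = H * D * Yᴴ - G * (Y * D * Yᴴ) := by
      simp only [Matrix.sub_mul, Matrix.mul_assoc]
    rw [this, hYY, hGM, hHY, sub_self]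
  refine ⟨h1, h2, ?_⟩
  -- By orthogonality to `Y`, the error covariance is just the covariance of the error with `h`.
  have : (H - G * Y) * D * (H - G * Y)ᴴ
      = H * D * Hᴴ - G * (Y * D * Hᴴ) - (H - G * Y) * D * Yᴴ * Gᴴ := by
    rw [conjTranspose_sub, conjTranspose_mul]
    simp only [Matrix.sub_mul, Matrix.mul_sub, Matrix.mul_assoc]
  rw [this, h2, h1, hHH, hYH, hG, Matrix.zero_mul, sub_zero, Matrix.mul_smul, Matrix.smul_mul,
    smul_smul, hrt]

end LinearEstimation

/-! ### Channels and pilot observations as images of one Gaussian source -/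

section PilotModel

variable {N K Q τ : ℕ}

/-- Index set of all the fading and noise variables. -/
abbrev SourceIndex (N K Q τ : ℕ) : Type := (Fin K × Fin Q) ⊕ (Fin N × Fin τ)

/-- Variances of the fading and noise variables. -/
noncomputable def sourceVariance (N K Q τ : ℕ) (σ : ℝ) : SourceIndex N K Q τ → ℝ≥0 :=
  Sum.elim (fun _ => 1) (fun _ => Real.toNNReal (σ ^ 2))

/-- Linear map producing the scattered part of the channel of user `k`. -/
def channelMatrix (τ : ℕ) (B : Fin K → Matrix (Fin N) (Fin Q) ℂ) (k : Fin K) :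
    Matrix (Fin N) (SourceIndex N K Q τ) ℂ :=
  Matrix.of fun n => Sum.elim (fun a => if a.1 = k then B k n a.2 else 0) (fun _ => 0)

/-- Linear map producing the despread noise of user `k`. -/
noncomputable def noiseMatrix (N Q : ℕ) (Φ : Matrix (Fin τ) (Fin K) ℂ) (k : Fin K) :
    Matrix (Fin N) (SourceIndex N K Q τ) ℂ :=
  Matrix.of fun n => Sum.elim (fun _ => 0)
    (fun b => if b.1 = n then ((1 / Real.sqrt τ : ℝ) : ℂ) * star (Φ b.2 k) else 0)

theorem ricianChannel_eq_affine {Ω : Type*} (μ : Fin K → Fin N → ℂ)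
    (B : Fin K → Matrix (Fin N) (Fin Q) ℂ) (ϖ : Fin K → Fin Q → Ω → ℂ)
    (Z : Fin N → Fin τ → Ω → ℂ) (k : Fin K) (ω : Ω) :
    ricianChannel μ B ϖ k ω = μ k + channelMatrix τ B k *ᵥ
      fun j => Sum.elim (fun a => ϖ a.1 a.2) (fun b => Z b.1 b.2) j ω := by
  unfold ricianChannel
  congr 1
  funext n
  simp only [channelMatrix, mulVec, dotProduct, of_apply, Fintype.sum_sum_type, Sum.elim_inl,
    Sum.elim_inr, zero_mul, Finset.sum_const_zero, add_zero, Fintype.sum_prod_type, ite_mul]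
  rw [Finset.sum_eq_single k (fun i _ hi => by simp [hi]) (by simp)]
  simp

theorem pilot_dotProduct {Φ : Matrix (Fin τ) (Fin K) ℂ} (hΦ : Φᴴ * Φ = (τ : ℂ) • 1)
    (i k : Fin K) : (fun t => Φ t i) ⬝ᵥ (star fun t => Φ t k) = if i = k then (τ : ℂ) else 0 := by
  have h := congrFun (congrFun hΦ k) i
  rw [Matrix.mul_apply, Matrix.smul_apply, Matrix.one_apply] at h
  simp only [conjTranspose_apply, smul_eq_mul, mul_ite, mul_one, mul_zero, eq_comm (a := k)] at h
  rw [← h, dotProduct]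
  exact Finset.sum_congr rfl fun t _ => mul_comm _ _

theorem pilotObs_eq_affine {Ω : Type*} (hτ : 0 < τ) {Φ : Matrix (Fin τ) (Fin K) ℂ}
    (hΦ : Φᴴ * Φ = (τ : ℂ) • 1) (ptr : Fin K → ℝ) (μ : Fin K → Fin N → ℂ)
    (B : Fin K → Matrix (Fin N) (Fin Q) ℂ) (ϖ : Fin K → Fin Q → Ω → ℂ)
    (Z : Fin N → Fin τ → Ω → ℂ) (k : Fin K) (ω : Ω) :
    pilotObs ptr Φ (ricianChannel μ B ϖ) Z k ω
      = ((Real.sqrt (τ * ptr k) : ℝ) : ℂ) • μ k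
        + (((Real.sqrt (τ * ptr k) : ℝ) : ℂ) • channelMatrix τ B k + noiseMatrix N Q Φ k) *ᵥ
          fun j => Sum.elim (fun a => ϖ a.1 a.2) (fun b => Z b.1 b.2) j ω := by
  -- The factor `τ` comes from `φ_k^T φ_k^* = τ`, so the effective amplitude is `τ^{-1/2} √p^tr τ =
  -- √(τ p^tr)`.
  have hsq : ((1 / Real.sqrt τ : ℝ) : ℂ) * (((Real.sqrt (ptr k) : ℝ) : ℂ) * τ)
      = ((Real.sqrt (τ * ptr k) : ℝ) : ℂ) := by
    have hpos : (0 : ℝ) < τ := by exact_mod_cast hτ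
    have : (1 / Real.sqrt τ) * (Real.sqrt (ptr k) * τ) = Real.sqrt (τ * ptr k) := by
      rw [Real.sqrt_mul hpos.le]
      have h1 := Real.mul_self_sqrt hpos.le
      have h2 := (Real.sqrt_pos.2 hpos).ne'
      field_simp
      rw [sq, h1, mul_comm]
    rw [← this]
    push_cast
    ring
  have hsig : (∑ i, ((Real.sqrt (ptr i) : ℝ) : ℂ) • vecMulVec (ricianChannel μ B ϖ i ω)
        (fun t => Φ t i)) *ᵥ (star fun t => Φ t k)
      = (((Real.sqrt (ptr k) : ℝ) : ℂ) * τ) • ricianChannel μ B ϖ k ω := by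
    rw [Matrix.sum_mulVec, Finset.sum_eq_single k]
    · rw [smul_mulVec, vecMulVec_mulVec, pilot_dotProduct hΦ, if_pos rfl]
      funext n
      simp
      ring
    · intro i _ hi
      rw [smul_mulVec, vecMulVec_mulVec, pilot_dotProduct hΦ, if_neg hi]
      simp
    · simp
  have hnoise : ((1 / Real.sqrt τ : ℝ) : ℂ) •
        ((Matrix.of fun n t => Z n t ω) *ᵥ (star fun t => Φ t k))
      = noiseMatrix N Q Φ k *ᵥ
        fun j => Sum.elim (fun a => ϖ a.1 a.2) (fun b => Z b.1 b.2) j ω := by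
    funext n
    simp only [noiseMatrix, mulVec, dotProduct, of_apply, Fintype.sum_sum_type, Sum.elim_inl,
      Sum.elim_inr, zero_mul, Finset.sum_const_zero, zero_add, Fintype.sum_prod_type, ite_mul,
      Pi.smul_apply, smul_eq_mul, Pi.star_apply]
    rw [Finset.sum_eq_single n (fun i _ hi => by simp [hi]) (by simp), Finset.mul_sum]
    exact Finset.sum_congr rfl fun t _ => by simp; ring
  rw [pilotObs, pilotMatrix, add_mulVec, smul_add, hsig, hnoise, smul_smul, hsq,
    ricianChannel_eq_affine μ B ϖ Z, smul_add, add_mulVec, smul_mulVec, add_assoc]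

/-- Different users draw on disjoint blocks of fading variables. -/
theorem channelMatrix_mul_channelMatrix (τ : ℕ) (σ : ℝ) (B : Fin K → Matrix (Fin N) (Fin Q) ℂ)
    (i k : Fin K) :
    channelMatrix τ B i * diagonal (fun j => (sourceVariance N K Q τ σ j : ℂ))
      * (channelMatrix τ B k)ᴴ = if i = k then B k * (B k)ᴴ else 0 := by
  ext n m
  rw [IsComplexGaussianFamily.mul_diagonal_mul_conjTranspose_apply]
  simp only [channelMatrix, sourceVariance, of_apply, Fintype.sum_sum_type, Sum.elim_inl,
    Sum.elim_inr, zero_mul, Finset.sum_const_zero, add_zero, Fintype.sum_prod_type, ite_mul]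
  rw [Finset.sum_eq_single i (fun l _ hl => by simp [hl]) (by simp)]
  simp only [↓reduceIte]
  split_ifs with h
  · subst h
    simp [Matrix.mul_apply]
  · simp

theorem channelMatrix_mul_noiseMatrix (σ : ℝ) (B : Fin K → Matrix (Fin N) (Fin Q) ℂ)
    (Φ : Matrix (Fin τ) (Fin K) ℂ) (i k : Fin K) :
    channelMatrix τ B i * diagonal (fun j => (sourceVariance N K Q τ σ j : ℂ))
      * (noiseMatrix N Q Φ k)ᴴ = 0 := by
  ext n m
  rw [IsComplexGaussianFamily.mul_diagonal_mul_conjTranspose_apply]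
  simp [channelMatrix, noiseMatrix, Fintype.sum_sum_type]

theorem noiseMatrix_mul_channelMatrix (σ : ℝ) (B : Fin K → Matrix (Fin N) (Fin Q) ℂ)
    (Φ : Matrix (Fin τ) (Fin K) ℂ) (i k : Fin K) :
    noiseMatrix N Q Φ k * diagonal (fun j => (sourceVariance N K Q τ σ j : ℂ))
      * (channelMatrix τ B i)ᴴ = 0 := by
  ext n m
  rw [IsComplexGaussianFamily.mul_diagonal_mul_conjTranspose_apply]
  simp [channelMatrix, noiseMatrix, Fintype.sum_sum_type]

/-- Despreading keeps the noise white at level `σ²`: the squared norm `τ` of the pilot cancels the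
two factors `τ^{-1/2}`. -/
theorem noiseMatrix_mul_noiseMatrix (hτ : 0 < τ) (σ : ℝ) {Φ : Matrix (Fin τ) (Fin K) ℂ}
    (hΦ : Φᴴ * Φ = (τ : ℂ) • 1) (k : Fin K) :
    noiseMatrix N Q Φ k * diagonal (fun j => (sourceVariance N K Q τ σ j : ℂ))
      * (noiseMatrix N Q Φ k)ᴴ = ((σ ^ 2 : ℝ) : ℂ) • (1 : Matrix (Fin N) (Fin N) ℂ) := by
  ext n m
  rw [IsComplexGaussianFamily.mul_diagonal_mul_conjTranspose_apply]
  simp only [noiseMatrix, sourceVariance, of_apply, Fintype.sum_sum_type, Sum.elim_inl,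
    Sum.elim_inr, zero_mul, Finset.sum_const_zero, zero_add, Fintype.sum_prod_type, ite_mul,
    Real.coe_toNNReal _ (sq_nonneg σ)]
  rw [Finset.sum_eq_single n (fun l _ hl => by simp [hl]) (by simp), Matrix.smul_apply,
    Matrix.one_apply]
  simp only [↓reduceIte]
  split_ifs with h
  · subst h
    have hd := pilot_dotProduct hΦ k k
    rw [if_pos rfl, dotProduct] at hd
    have hτ' : ((1 / Real.sqrt τ : ℝ) : ℂ) * ((1 / Real.sqrt τ : ℝ) : ℂ) * τ = 1 := by
      have hpos : (0 : ℝ) < τ := by exact_mod_cast hτ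
      have : (1 / Real.sqrt τ) * (1 / Real.sqrt τ) * τ = 1 := by
        rw [div_mul_div_comm, Real.mul_self_sqrt hpos.le]
        field_simp
      exact_mod_cast this
    calc _ = (((1 / Real.sqrt τ : ℝ) : ℂ) * ((1 / Real.sqrt τ : ℝ) : ℂ) * ((σ ^ 2 : ℝ) : ℂ))
          * ∑ t, Φ t k * (star fun t => Φ t k) t := by
          rw [Finset.mul_sum]
          refine Finset.sum_congr rfl fun t _ => ?_
          simp
          ring
      _ = _ := by
          rw [hd, mul_right_comm, hτ']
          simp
  · simp

end PilotModel

/-! ### Assembly of the main theorem -/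

theorem mainTheorem3
    {Ω : Type*} [MeasurableSpace Ω] (P : Measure Ω) [IsProbabilityMeasure P]
    {N K Q τ : ℕ}
    -- transmit powers, pilot powers, noise level, orthogonal pilots
    (p ptr : Fin K → ℝ) (hp : ∀ k, 0 ≤ p k) (hptr : ∀ k, 0 ≤ ptr k)
    (σ : ℝ) (hσ : 0 < σ)
    (hτ : K ≤ τ) (Φ : Matrix (Fin τ) (Fin K) ℂ) (hΦ : Φᴴ * Φ = (τ : ℂ) • 1)
    -- fading coefficients and pilot-phase noise, jointly independent
    (ϖ : Fin K → Fin Q → Ω → ℂ) (Z : Fin N → Fin τ → Ω → ℂ)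
    (hϖm : ∀ k q, Measurable (ϖ k q)) (hZm : ∀ n t, Measurable (Z n t))
    (hϖ : ∀ k q, HasLaw (ϖ k q) (complexGaussian 1) P)
    (hZ : ∀ n t, HasLaw (Z n t) (complexGaussian (Real.toNNReal (σ ^ 2))) P)
    (hind : iIndepFun (fun j : (Fin K × Fin Q) ⊕ (Fin N × Fin τ) =>
      Sum.elim (fun a => ϖ a.1 a.2) (fun a => Z a.1 a.2) j) P)
    -- Rician statistics, channels, pilot observations and LMMSE estimates
    (μ : Fin K → Fin N → ℂ) (B : Fin K → Matrix (Fin N) (Fin Q) ℂ)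
    (R : Fin K → Matrix (Fin N) (Fin N) ℂ) (hR : ∀ k, R k = B k * (B k)ᴴ)
    (h y hhat : Fin K → Ω → Fin N → ℂ)
    (hh : ∀ k, h k = ricianChannel μ B ϖ k)
    (hy : ∀ k, y k = pilotObs ptr Φ h Z k)
    (hhhat : ∀ k, hhat k = lmmse P (h k) (y k))
    -- covariance and second-moment matrices of estimates, errors and channels
    (Chat Ce Sh Shat : Fin K → Matrix (Fin N) (Fin N) ℂ)
    (hChat : ∀ k, Chat k =
      crossMoment P (fun ω => hhat k ω - μ k) (fun ω => hhat k ω - μ k))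
    (hCe : ∀ k, Ce k =
      crossMoment P (fun ω => h k ω - hhat k ω) (fun ω => h k ω - hhat k ω))
    (hSh : ∀ k, Sh k = crossMoment P (h k) (h k))
    (hShat : ∀ k, Shat k = crossMoment P (hhat k) (hhat k))
    (k : Fin K) :
    -- the LMMSE estimate, explicitly and as a conditional expectation
    (∀ ω, hhat k ω = μ k +
      ((Real.sqrt (τ * ptr k) : ℝ) : ℂ) •
        ((R k * (((τ * ptr k : ℝ) : ℂ) • R k + ((σ ^ 2 : ℝ) : ℂ) • 1)⁻¹) *ᵥ
          (y k ω - ((Real.sqrt (τ * ptr k) : ℝ) : ℂ) • μ k))) ∧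
    (P[h k | MeasurableSpace.comap (y k) inferInstance] =ᵐ[P] hhat k) ∧
    -- the moments exist
    (∀ i, MemLp (h i) 2 P ∧ MemLp (hhat i) 2 P ∧
      Integrable (fun ω => ‖star (mrcCombiner hhat k ω) ⬝ᵥ h i ω‖ ^ 2) P) ∧
    -- the second-order statistics in terms of `μ` and `R`
    (∀ i, Chat i = ((τ * ptr i : ℝ) : ℂ) •
        (R i * (((τ * ptr i : ℝ) : ℂ) • R i + ((σ ^ 2 : ℝ) : ℂ) • 1)⁻¹ * R i) ∧
      Ce i = R i - Chat i ∧
      Ce i = R i * (1 + ((τ * ptr i / σ ^ 2 : ℝ) : ℂ) • R i)⁻¹ ∧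
      (Chat i).PosSemidef ∧ (Ce i).PosSemidef ∧
      Sh i = R i + Matrix.vecMulVec (μ i) (star (μ i)) ∧
      Shat i = Chat i + Matrix.vecMulVec (μ i) (star (μ i))) ∧
    -- the mean effective gain is `α_k`; so is the combiner's mean squared norm
    (∫ ω, star (mrcCombiner hhat k ω) ⬝ᵥ h k ω ∂P = (mrcAlpha (Chat k) (μ k) : ℂ)) ∧
    (∫ ω, ‖WithLp.toLp 2 (mrcCombiner hhat k ω)‖ ^ 2 ∂P = mrcAlpha (Chat k) (μ k)) ∧
    -- the self-interference term is the variance of the effective gain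
    (∫ ω, ‖star (mrcCombiner hhat k ω) ⬝ᵥ h k ω‖ ^ 2 ∂P
        - ‖∫ ω, star (mrcCombiner hhat k ω) ⬝ᵥ h k ω ∂P‖ ^ 2
      = mrcPhi (Chat k) (Ce k) (Shat k) (μ k)) ∧
    -- denominator and SINR in closed form
    (uatfDenominator P p σ h (mrcCombiner hhat) k
      = mrcInterference p σ μ Chat Ce Sh Shat k) ∧
    (0 < mrcAlpha (Chat k) (μ k) → 0 < mrcInterference p σ μ Chat Ce Sh Shat k) ∧
    (uatfSINR P p σ h (mrcCombiner hhat) k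
      = p k * mrcAlpha (Chat k) (μ k) ^ 2
          / mrcInterference p σ μ Chat Ce Sh Shat k) ∧
    -- the geometry-based channel at every rotation configuration is of this Rician form
    (∀ (G : RAGeometry N K Q) (F : Fin N → EuclideanSpace ℝ (Fin 3)), (∀ n, ‖F n‖ = 1) →
      ∀ j, G.channel F ϖ j = ricianChannel (G.losMean F) (G.nlosMatrix F) ϖ j) := by
  classical
  set ξ : SourceIndex N K Q τ → Ω → ℂ :=
    Sum.elim (fun a => ϖ a.1 a.2) (fun b => Z b.1 b.2) with hξdef
  have hξ : IsComplexGaussianFamily P (sourceVariance N K Q τ σ) ξ := by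
    refine ⟨?_, ?_, hind⟩
    · rintro (a | b)
      exacts [hϖm _ _, hZm _ _]
    · rintro (a | b)
      exacts [hϖ _ _, hZ _ _]
  -- The existence of the user `k` forces `K ≥ 1`, hence `τ ≥ 1`.
  have hτ0 : 0 < τ := (Nat.zero_le _).trans_lt (k.isLt.trans_le hτ)
  have hσ2 : 0 < σ ^ 2 := by positivity
  have ht : ∀ i, 0 ≤ τ * ptr i := fun i => mul_nonneg (Nat.cast_nonneg _) (hptr i)
  set D := diagonal (fun j => (sourceVariance N K Q τ σ j : ℂ)) with hD
  set r : Fin K → ℝ := fun i => Real.sqrt (τ * ptr i) with hr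
  set H := channelMatrix (Q := Q) τ B with hH
  set Y : Fin K → Matrix (Fin N) (SourceIndex N K Q τ) ℂ :=
    fun i => ((r i : ℝ) : ℂ) • H i + noiseMatrix N Q Φ i with hY
  set M : Fin K → Matrix (Fin N) (Fin N) ℂ :=
    fun i => ((τ * ptr i : ℝ) : ℂ) • R i + ((σ ^ 2 : ℝ) : ℂ) • 1 with hM
  set G : Fin K → Matrix (Fin N) (Fin N) ℂ :=
    fun i => ((r i : ℝ) : ℂ) • (R i * (M i)⁻¹) with hG
  have hrr : ∀ i, r i * r i = τ * ptr i := fun i => Real.mul_self_sqrt (ht i)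
  have hRpsd : ∀ i, (R i).PosSemidef := fun i => hR i ▸ posSemidef_self_mul_conjTranspose (B i)
  have hHH : ∀ i, H i * D * (H i)ᴴ = R i := fun i => by
    rw [channelMatrix_mul_channelMatrix, if_pos rfl, hR]
  -- There is no pilot contamination: `y_l` involves only `h_l` and noise, which later makes `h_i`
  -- independent of the estimate for `k ≠ i`.
  have hHYne : ∀ i l, i ≠ l → H i * D * (Y l)ᴴ = 0 := fun i l hil => by
    simp only [hY]
    rw [conjTranspose_add, conjTranspose_smul, Matrix.mul_add, Matrix.mul_smul,
      channelMatrix_mul_channelMatrix, if_neg hil, channelMatrix_mul_noiseMatrix, smul_zero,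
      add_zero]
  have hHY : ∀ i, H i * D * (Y i)ᴴ = ((r i : ℝ) : ℂ) • R i := fun i => by
    simp only [hY]
    rw [conjTranspose_add, conjTranspose_smul, Matrix.mul_add, Matrix.mul_smul, hHH,
      channelMatrix_mul_noiseMatrix, add_zero]
    simp
  have hYH : ∀ i, Y i * D * (H i)ᴴ = ((r i : ℝ) : ℂ) • R i := fun i => by
    simp only [hY]
    rw [Matrix.add_mul, Matrix.add_mul, Matrix.smul_mul, Matrix.smul_mul, hHH,
      noiseMatrix_mul_channelMatrix, add_zero]
  have hYY : ∀ i, Y i * D * (Y i)ᴴ = M i := fun i => by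
    have h1 : Y i * D * (Y i)ᴴ
        = ((r i : ℝ) : ℂ) • (H i * D * (Y i)ᴴ) + noiseMatrix N Q Φ i * D * (Y i)ᴴ := by
      nth_rewrite 1 [hY]
      simp only [Matrix.add_mul, Matrix.smul_mul]
    have h2 : noiseMatrix N Q Φ i * D * (Y i)ᴴ = ((σ ^ 2 : ℝ) : ℂ) • 1 := by
      simp only [hY]
      rw [conjTranspose_add, conjTranspose_smul, Matrix.mul_add, Matrix.mul_smul,
        noiseMatrix_mul_channelMatrix, noiseMatrix_mul_noiseMatrix hτ0 σ hΦ, smul_zero, zero_add]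
    rw [h1, h2, hHY, smul_smul, ← Complex.ofReal_mul, hrr]
  have hh' : ∀ i, h i = fun ω => μ i + H i *ᵥ fun j => ξ j ω := fun i => by
    rw [hh]
    exact funext fun ω => ricianChannel_eq_affine μ B ϖ Z i ω
  have hy' : ∀ i, y i = fun ω => ((r i : ℝ) : ℂ) • μ i + Y i *ᵥ fun j => ξ j ω := fun i => by
    rw [hy, show h = ricianChannel μ B ϖ from funext hh]
    exact funext fun ω => pilotObs_eq_affine hτ0 hΦ ptr μ B ϖ Z i ω
  have hest : ∀ i ω, hhat i ω = μ i + G i *ᵥ (y i ω - ((r i : ℝ) : ℂ) • μ i) := fun i ω => by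
    rw [hhhat, lmmse, hh', hy', hξ.meanVec_affine, hξ.meanVec_affine, hξ.crossCov_affine,
      hξ.crossCov_affine, hHY, hYY, Matrix.smul_mul]
  have hhat' : ∀ i, hhat i = fun ω => μ i + (G i * Y i) *ᵥ fun j => ξ j ω := fun i => by
    funext ω
    rw [hest, hy', add_sub_cancel_left, mulVec_mulVec]
  have hcov := fun i => lmmse_covariances (hRpsd i) (ht i) hσ2 (hrr i) (hHH i) (hHY i) (hYH i)
    (hYY i) (G := G i) rfl
  set e : Fin K → Ω → Fin N → ℂ := fun i ω => (H i - G i * Y i) *ᵥ fun j => ξ j ω with he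
  have hdec : ∀ i ω, h i ω = hhat i ω + e i ω := fun i ω => by
    rw [hh', hhat', he]
    simp only [sub_mulVec]
    abel
  have hChat' : ∀ i, Chat i = (G i * Y i) * D * (G i * Y i)ᴴ := fun i => by
    rw [hChat, hhat']
    simp only [add_sub_cancel_left]
    exact hξ.crossMoment_mulVec _ _
  have hCe' : ∀ i, Ce i = (H i - G i * Y i) * D * (H i - G i * Y i)ᴴ := fun i => by
    rw [hCe]
    simp only [hdec, add_sub_cancel_left]
    exact hξ.crossMoment_mulVec _ _
  have hstat : ∀ i, Chat i = ((τ * ptr i : ℝ) : ℂ) • (R i * (M i)⁻¹ * R i) ∧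
      Ce i = R i - Chat i ∧
      Ce i = R i * (1 + ((τ * ptr i / σ ^ 2 : ℝ) : ℂ) • R i)⁻¹ ∧
      (Chat i).PosSemidef ∧ (Ce i).PosSemidef ∧
      Sh i = R i + Matrix.vecMulVec (μ i) (star (μ i)) ∧
      Shat i = Chat i + Matrix.vecMulVec (μ i) (star (μ i)) := fun i => by
    have h1 := (hChat' i).trans (hcov i).1
    have h2 : Ce i = R i - Chat i := by rw [hCe', hChat', (hcov i).2.2]
    refine ⟨h1, h2, ?_, ?_, ?_, ?_, ?_⟩
    · rw [h2, h1]
      exact sub_smul_mul_inv_mul_eq (hRpsd i) (ht i) hσ2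
    · rw [hChat']
      exact IsComplexGaussianFamily.posSemidef_mul_diagonal _ _
    · rw [hCe']
      exact IsComplexGaussianFamily.posSemidef_mul_diagonal _ _
    · rw [hSh, hh', hξ.crossMoment_affine_self, hHH]
    · rw [hShat, hhat', hξ.crossMoment_affine_self, hChat']
  have hhm : ∀ i n, HasAllMoments P (fun ω => h i ω n) := fun i n => by
    rw [hh']
    exact hξ.affine_hasAllMoments _ _ n
  have hhatm : ∀ i n, HasAllMoments P (fun ω => hhat i ω n) := fun i n => by
    rw [hhat']
    exact hξ.affine_hasAllMoments _ _ n
  have hem : ∀ i n, HasAllMoments P (fun ω => e i ω n) := fun i n =>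
    hξ.dotProduct_hasAllMoments _
  have he0 : ∀ i n, ∫ ω, e i ω n ∂P = 0 := fun i n => hξ.integral_dotProduct _
  have hemeas : ∀ i, Measurable (e i) := fun i =>
    (Continuous.matrix_mulVec continuous_const continuous_id).measurable.comp hξ.vecMeasurable
  have hymeas : ∀ i, Measurable (y i) := fun i => by
    rw [hy']
    exact measurable_const.add ((Continuous.matrix_mulVec continuous_const
      continuous_id).measurable.comp hξ.vecMeasurable)
  have hfmeas : ∀ i, Measurable fun x => μ i + G i *ᵥ (x - ((r i : ℝ) : ℂ) • μ i) := fun i =>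
    (continuous_const.add (Continuous.matrix_mulVec continuous_const
      (continuous_id.sub continuous_const))).measurable
  have hey : ∀ i, IndepFun (e i) (y i) P := fun i => by
    rw [hy']
    exact (hξ.indepFun_mulVec (hcov i).2.1).comp measurable_id (measurable_const_add _)
  have hhatfun : ∀ i, hhat i = fun ω => μ i + G i *ᵥ (y i ω - ((r i : ℝ) : ℂ) • μ i) :=
    fun i => funext (hest i)
  have hehat : ∀ i, IndepFun (e i) (hhat i) P := fun i => by
    rw [hhatfun]
    exact (hey i).comp measurable_id (hfmeas i)
  have hcross : ∀ i, i ≠ k → IndepFun (h i) (hhat k) P := fun i hi => by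
    rw [hh', hhatfun]
    have h1 : IndepFun (fun ω => μ i + H i *ᵥ fun j => ξ j ω) (y k) P := by
      rw [hy']
      exact (hξ.indepFun_mulVec (hHYne i k hi)).comp (measurable_const_add _)
        (measurable_const_add _)
    exact h1.comp measurable_id (hfmeas k)
  have hnorm := hξ.integral_norm_sq_affine (μ k) (G k * Y k) (hChat' k)
  have hnorm1 : ∫ ω, ‖WithLp.toLp 2 (hhat k ω)‖ ^ 2 ∂P = mrcAlpha (Chat k) (μ k) := by
    rw [hhat']
    exact hnorm.1
  have hgain : ∫ ω, star (hhat k ω) ⬝ᵥ h k ω ∂P = (mrcAlpha (Chat k) (μ k) : ℂ) := by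
    simp only [hdec k]
    rw [integral_star_dotProduct_add (hem k) (hhatm k) (hehat k) (he0 k), hnorm1]
  have hCeM : Ce k = crossMoment P (e k) (e k) := by
    rw [hCe']
    exact (hξ.crossMoment_mulVec _ _).symm
  have hsecond : ∫ ω, ‖star (hhat k ω) ⬝ᵥ h k ω‖ ^ 2 ∂P
      = mrcAlpha (Chat k) (μ k) ^ 2 + mrcPhi (Chat k) (Ce k) (Shat k) (μ k) := by
    have h2 : ∫ ω, (‖WithLp.toLp 2 (hhat k ω)‖ ^ 2) ^ 2 ∂P
        = mrcAlpha (Chat k) (μ k) ^ 2 + (Chat k ^ 2).trace.re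
          + 2 * (star (μ k) ⬝ᵥ (Chat k *ᵥ μ k)).re := by
      rw [hhat']
      exact hnorm.2
    simp only [hdec k]
    rw [integral_norm_sq_star_dotProduct_add (hem k) (hhatm k) (hehat k) (he0 k), h2, mrcPhi,
      hCeM, hShat]
    ring
  have hother : ∀ i, i ≠ k → ∫ ω, ‖star (hhat k ω) ⬝ᵥ h i ω‖ ^ 2 ∂P
      = (Sh i * Shat k).trace.re := fun i hi => by
    rw [integral_norm_sq_star_dotProduct_of_indepFun (hhm i) (hhatm k) (hcross i hi), hSh, hShat]
  have hgain2 : ‖∫ ω, star (hhat k ω) ⬝ᵥ h k ω ∂P‖ ^ 2 = mrcAlpha (Chat k) (μ k) ^ 2 := by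
    rw [hgain, Complex.norm_real, Real.norm_eq_abs, sq_abs]
  have hden : uatfDenominator P p σ h (mrcCombiner hhat) k
      = mrcInterference p σ μ Chat Ce Sh Shat k := by
    simp only [uatfDenominator, mrcCombiner, mrcInterference]
    rw [hgain2, hnorm1, ← Finset.add_sum_erase _ _ (Finset.mem_univ k), hsecond,
      Finset.sum_congr rfl fun i hi => by rw [hother i (Finset.ne_of_mem_erase hi)]]
    ring
  refine ⟨fun ω => ?_, ?_, fun i => ⟨?_, ?_, ?_⟩, hstat, hgain, hnorm1, ?_, hden, fun hα => ?_,
    ?_, fun geo F _ j => ?_⟩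
  · rw [hest, hG, smul_mulVec]
  · have hdec' : h k = fun ω => (μ k + G k *ᵥ (y k ω - ((r k : ℝ) : ℂ) • μ k)) + e k ω :=
      funext fun ω => by rw [hdec, hest]
    have hint : ∀ i, Integrable (e i) P := fun i =>
      memLp_one_iff_integrable.1 (MemLp.of_eval fun n => hem i n 1 (by simp))
    have hint' : Integrable (hhat k) P :=
      memLp_one_iff_integrable.1 (MemLp.of_eval fun n => hhatm k n 1 (by simp))
    have he00 : ∫ ω, e k ω ∂P = 0 := funext fun n => by
      rw [eval_integral fun n => (hem k n).integrable, he0]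
      rfl
    rw [hdec', hhatfun]
    rw [hhatfun] at hint'
    exact condExp_comap_eq_of_indepFun (hymeas k) (hemeas k) (hint k) he00 (hfmeas k) hint' (hey k)
  · exact MemLp.of_eval fun n => hhm i n 2 (by simp)
  · exact MemLp.of_eval fun n => hhatm i n 2 (by simp)
  · exact ((hasAllMoments_star_dotProduct (hhm i) (hhatm k)).norm.pow 1).integrable
  · simp only [mrcCombiner]
    rw [hsecond, hgain2, add_sub_cancel_left]
  · have hΦ0 : 0 ≤ mrcPhi (Chat k) (Ce k) (Shat k) (μ k) := by
      have h1 : 0 ≤ (Chat k ^ 2).trace.re := by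
        rw [IsComplexGaussianFamily.trace_sq_re_of_isHermitian (hstat k).2.2.2.1.isHermitian]
        positivity
      have h2 : 0 ≤ (star (μ k) ⬝ᵥ (Chat k *ᵥ μ k)).re :=
        (Complex.le_def.1 ((hstat k).2.2.2.1.dotProduct_mulVec_nonneg (μ k))).1
      -- The trace is the mean of `|ĥ^H e|²`, so its sign needs no result on traces of products.
      have h3 : 0 ≤ (Ce k * Shat k).trace.re := by
        rw [hCeM, hShat, ← integral_norm_sq_star_dotProduct_of_indepFun (hem k) (hhatm k)
          (hehat k)]
        exact integral_nonneg fun ω => by positivity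
      unfold mrcPhi
      positivity
    have hs : 0 ≤ ∑ i ∈ Finset.univ.erase k, p i * (Sh i * Shat k).trace.re :=
      Finset.sum_nonneg fun i hi => mul_nonneg (hp i) <| by
        rw [← hother i (Finset.ne_of_mem_erase hi)]
        exact integral_nonneg fun ω => by positivity
    have h1 := mul_nonneg (hp k) hΦ0
    have h2 := mul_pos hσ2 hα
    unfold mrcInterference
    linarith
  -- Numerators and denominators agree separately, so a zero denominator needs no case: both
  -- quotients are `0` by convention.
  · rw [uatfSINR, hden]
    simp only [mrcCombiner]
    rw [hgain2]
  · funext ω n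
    simp only [RAGeometry.channel, ricianChannel, RAGeometry.losMean, RAGeometry.nlosMatrix,
      Pi.add_apply, mulVec, dotProduct, of_apply]
    congr 1
    exact Finset.sum_congr rfl fun q _ => by ring
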